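/- For complex $z\in\mathbb C\setminus(-\infty,0]$ let $\zeta(w,z)$ be the Hurwitz zeta function, i.e. the analytic continuation in $w$ to $\mathbb C\setminus\{1\}$ of $\sum_{n\ge 0}(n+z)^{-w}$ ($\operatorname{Re} w>1$, principal powers), and for $k\ge 1$ put $$\log\mathcal G_k(z):=\frac{\partial}{\partial w}\zeta(w,z)\Big|_{w=1-k},$$ the logarithm of the Milnor gamma function of depth $k$. Let $\psi=\Gamma'/\Gamma$ be the digamma function, $B_k(z)$ the Bernoulli polynomials, $(a)_r:=a(a+1)\cdots(a+r-1)$, $H(n):=\sum_{j=1}^{n}\frac1j$ (with $H(0)=0$), and $H(a,b):=H(b)-H(a-1)$ for integers $a\ge 1$, $b\ge 0$; so $H(a,b)=\sum_{j=a}^{b}\frac1j$ whenever $a\le b+1$. Let $m\ge 0$ and $r\ge 1$ be integers and let $z,t\in\mathbb C$ be such that the segment from $z$ to $z+t$ does not meet $(-\infty,0]$. Let $$\Phi^m_r(t,z):=\int_0^t\int_0^{\xi_r}\cdots\int_0^{\xi_2}\xi_1^m\,\psi(\xi_1+z)\,d\xi_1\cdots d\xi_r$$ ($r$ integrals, taken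 along straight segments). Then $$\Phi^m_r(t,z)=\sum_{k=r}^{m+r}\frac{(-1)^{k+r}}{(r-1)!}\binom{m}{k-r}t^{m+r-k}\log\mathcal G_k(t+z)+P^m_r(t,z),$$ where $P^m_r(t,z)$ is the polynomial in $t$ given by $$\begin{aligned}P^m_r(t,z)={}&\frac{H(r,m)}{(m+1)_r}t^{m+r}+\frac{(-1)^{m+r-1}}{r!}\sum_{l=r}^{m+r-1}\binom{l}{r}^{-1}\frac{(-1)^lB_{m+r-l}(z)}{m+r-l}t^l\\&+\frac{(-1)^{m+1}}{(r-1)!}\sum_{l=1}^{r-1}\binom{r-1}{l}\frac{H(r-l,r-1)B_{m+r-l}(z)}{m+r-l}t^l+\frac{(-1)^{m+1}}{(r-1)!}\sum_{k=0}^{r-1}\binom{r-1}{k}t^k\log\mathcal G_{m+r-k}(z).\end{aligned}$$ As a polynomial in $t$, $P^m_r(t,z)$ has degree at most $m+r$, and exactly $m+r$ if $m\ne r-1$. -/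

import Mathlib

open Polynomial

namespace DepthGamma

/-- `f` is the analytic continuation, to the punctured plane `ℂ ∖ {1}`, of the series
`∑_{n ≥ 0} (n + z)^{-w}` (principal powers), which converges for `Re w > 1`.
By the identity theorem `f` is determined on `ℂ ∖ {1}` by this property. -/
def IsHurwitzContinuation (z : ℂ) (f : ℂ → ℂ) : Prop :=
  DifferentiableOn ℂ f {1}ᶜ ∧
    ∀ w : ℂ, 1 < w.re → HasSum (fun n : ℕ => ((n : ℂ) + z) ^ (-w)) (f w)

/-- The Hurwitz zeta function `w ↦ ζ(w, z)`: the analytic continuation of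
`∑_{n ≥ 0} (n + z)^{-w}` (the value at the pole `w = 1` is irrelevant). -/
noncomputable def hurwitzZeta (z : ℂ) : ℂ → ℂ :=
  Classical.epsilon (IsHurwitzContinuation z)

/-- `log 𝒢_k(z) = ∂/∂w ζ(w, z)` at `w = 1 - k`. This is the branch of the logarithm of the
Milnor gamma function that is analytic in `z` on the plane cut along `(-∞, 0]`. -/
noncomputable def logMilnorGamma (k : ℕ) (z : ℂ) : ℂ :=
  deriv (hurwitzZeta z) (1 - (k : ℂ))

/-- The Milnor gamma function `𝒢_k(z)` of depth `k`. -/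
noncomputable def milnorGamma (k : ℕ) (z : ℂ) : ℂ :=
  Complex.exp (logMilnorGamma k z)

/-- `∫_0^t f(ξ) dξ`, along the straight segment from `0` to `t`. -/
noncomputable def segmentIntegral (f : ℂ → ℂ) (t : ℂ) : ℂ :=
  t * ∫ u in (0 : ℝ)..1, f ((u : ℂ) * t)

/-- The `r`-fold iterated integral
`Φ^m_r(t, z) = ∫_0^t ∫_0^{ξ_r} ⋯ ∫_0^{ξ_2} ξ_1^m ψ(ξ_1 + z) dξ_1 ⋯ dξ_r`. -/
noncomputable def iteratedDigamma (m r : ℕ) (t z : ℂ) : ℂ :=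
  (segmentIntegral^[r] (fun ξ => ξ ^ m * Complex.digamma (ξ + z))) t

/-- `H(a, b) = H(b) - H(a - 1)`, where `H(n) = ∑_{1 ≤ j ≤ n} 1/j`; used for `a ≥ 1`. -/
def harmonicDiff (a b : ℕ) : ℚ := harmonic b - harmonic (a - 1)

/-- For `1 ≤ a ≤ b + 1` this is the sum `∑_{a ≤ j ≤ b} 1/j`, empty if `a = b + 1`. -/
theorem harmonicDiff_eq_sum (a b : ℕ) (ha : 1 ≤ a) (hab : a ≤ b + 1) :
    harmonicDiff a b = ∑ j ∈ Finset.Icc a b, (j : ℚ)⁻¹ := by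
  obtain ⟨c, rfl⟩ : ∃ c, a = c + 1 := ⟨a - 1, by omega⟩
  have h : ∀ d, harmonicDiff (c + 1) (c + d) = ∑ j ∈ Finset.Icc (c + 1) (c + d), (j : ℚ)⁻¹ := by
    intro d
    induction d with
    | zero => simp [harmonicDiff]
    | succ d ih =>
      rw [← add_assoc, Finset.sum_Icc_succ_top (by omega), ← ih]
      simp only [harmonicDiff, harmonic_succ]
      ring
  obtain ⟨d, rfl⟩ : ∃ d, b = c + d := ⟨b - c, by omega⟩
  exact h d

/-- The value `B_k(z)` of the Bernoulli polynomial at a complex number. -/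
noncomputable def bernoulliValue (k : ℕ) (z : ℂ) : ℂ := aeval z (Polynomial.bernoulli k)

/-- The polynomial `P^m_r(t, z)` in the variable `t`. -/
noncomputable def remainderPoly (m r : ℕ) (z : ℂ) : ℂ[X] :=
  C ((harmonicDiff r m : ℂ) / ((m + 1).ascFactorial r : ℂ)) * X ^ (m + r)
  + C ((-1) ^ (m + r - 1) / (r.factorial : ℂ)) *
      ∑ l ∈ Finset.Icc r (m + r - 1),
        C ((l.choose r : ℂ)⁻¹ *
          ((-1) ^ l * bernoulliValue (m + r - l) z / ((m + r - l : ℕ) : ℂ))) * X ^ l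
  + C ((-1) ^ (m + 1) / ((r - 1).factorial : ℂ)) *
      ∑ l ∈ Finset.Icc 1 (r - 1),
        C (((r - 1).choose l : ℂ) *
          ((harmonicDiff (r - l) (r - 1) : ℂ) * bernoulliValue (m + r - l) z
            / ((m + r - l : ℕ) : ℂ))) * X ^ l
  + C ((-1) ^ (m + 1) / ((r - 1).factorial : ℂ)) *
      ∑ k ∈ Finset.range r,
        C (((r - 1).choose k : ℂ) * logMilnorGamma (m + r - k) z) * X ^ k

end DepthGamma

/-! Put R(w, z) = (w - 1) ζ(w, z) (`regZeta`). It is entire in w, and ∂R/∂z = (1 - w) R(w + 1, z)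
and R(1 - k, z) = B_k(z). Differentiating the first relation in w gives (log 𝒢_{k+1})' = k log 𝒢_k +
B_k / k for k ≥ 1 (`hasDerivAt_logMilnorGamma`). The case k = 0 is (log 𝒢_1)' = ψ
(`hasDerivAt_logMilnorGamma_one_digamma`): Bohr–Mollerup on the positive reals, then the identity
theorem on the slit plane.

With these rules the right-hand side of order r vanishes at t = 0, and its t-derivative is the
right-hand side of order r - 1, or t^m ψ(t + z) if r = 1. In the gamma part, the derivatives of the
powers of t cancel against part of the derivatives of log 𝒢, which leaves a multiple of the same sum
of lower order and a sum of Bernoulli values (`hasDerivAt_milnorPart`). Finite-difference identities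
expand that sum in powers of t (`bernoulliSum_zero`, `bernoulliSum_succ`), and the coefficients of P
are those that absorb it (`remainderCoeff_zero`, `remainderCoeff_succ`, `leadingCoeff_succ`).
Integrating along the segment, by induction on r, gives the formula
(`iteratedDigamma_eq_closedForm`).

The continuation comes from R(w, z) = z^{1-w} + (w - 1) ∫_0^1 (1 - v) R(w + 1, z + v) dv, whose
right side needs R only one unit further right. -/

namespace DepthGamma

open Set Filter Topology MeasureTheory

/-! ### Integrals depending on a parameter, and exchange of derivatives -/

section ParametricIntegrals

theorem continuousOn_intervalIntegral_param {X : Type*} [TopologicalSpace X] {f : X → ℝ → ℂ}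
    {S : Set X} {a b : ℝ} (hab : a ≤ b)
    (hf : ContinuousOn (Function.uncurry f) (S ×ˢ Icc a b)) :
    ContinuousOn (fun x => ∫ v in a..b, f x v) S := by
  rw [continuousOn_iff_continuous_domRestrict]
  -- Projecting the integration variable onto [a, b] makes the integrand continuous for all real v
  -- without changing the integral.
  have hc : Continuous (Function.uncurry (fun (x : S) (v : ℝ) => f x (projIcc a b hab v))) := by
    refine hf.comp_continuous (f := fun p : S × ℝ => ((p.1 : X), (projIcc a b hab p.2 : ℝ)))
      (by fun_prop) ?_
    intro p
    exact ⟨p.1.2, (projIcc a b hab p.2).2⟩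
  have := intervalIntegral.continuous_parametric_intervalIntegral_of_continuous'
    (μ := volume) hc a b
  refine this.congr fun x => ?_
  refine intervalIntegral.integral_congr fun v hv => ?_
  rw [uIcc_of_le hab] at hv
  simp [projIcc_of_mem hab hv]

theorem hasDerivAt_intervalIntegral_param {f f' : ℂ → ℝ → ℂ} {S : Set ℂ} {a b : ℝ}
    (hS : IsOpen S) (hab : a ≤ b)
    (hf : ContinuousOn (Function.uncurry f) (S ×ˢ Icc a b))
    (hf' : ContinuousOn (Function.uncurry f') (S ×ˢ Icc a b))
    (hd : ∀ x ∈ S, ∀ v ∈ Icc a b, HasDerivAt (fun x => f x v) (f' x v) x)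
    {x₀ : ℂ} (hx₀ : x₀ ∈ S) :
    HasDerivAt (fun x => ∫ v in a..b, f x v) (∫ v in a..b, f' x₀ v) x₀ := by
  have slice : ∀ {g : ℂ → ℝ → ℂ}, ContinuousOn (Function.uncurry g) (S ×ˢ Icc a b) →
      ∀ x ∈ S, ContinuousOn (g x) (Icc a b) := fun hg x hx =>
    hg.comp (f := fun v : ℝ => (x, v)) (by fun_prop) fun v hv => ⟨hx, hv⟩
  obtain ⟨r, hr, hrS⟩ := Metric.nhds_basis_closedBall.mem_iff.1 (hS.mem_nhds hx₀)
  obtain ⟨M, hM⟩ := ((isCompact_closedBall x₀ r).prod isCompact_Icc).exists_bound_of_continuousOn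
    (hf'.mono (prod_mono_left hrS))
  have hI : uIoc a b ⊆ Icc a b := by rw [uIoc_of_le hab]; exact Ioc_subset_Icc_self
  have meas : ∀ {g : ℝ → ℂ}, ContinuousOn g (Icc a b) →
      AEStronglyMeasurable g (volume.restrict (uIoc a b)) := fun hg =>
    (hg.mono hI).aestronglyMeasurable measurableSet_uIoc
  refine (intervalIntegral.hasDerivAt_integral_of_dominated_loc_of_deriv_le
    (bound := fun _ => M) (s := Metric.closedBall x₀ r)
    (Metric.closedBall_mem_nhds _ hr) ?_ ?_ (meas (slice hf' x₀ hx₀)) ?_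
    intervalIntegrable_const ?_).2
  · filter_upwards [hS.mem_nhds hx₀] with x hx using meas (slice hf x hx)
  · exact (slice hf x₀ hx₀).intervalIntegrable_of_Icc hab
  · exact Eventually.of_forall fun v hv x hx => hM (x, v) ⟨hx, hI hv⟩
  · exact Eventually.of_forall fun v hv x hx => hd x (hrS hx) v (hI hv)

/-- Cauchy's formula for the derivative, with the circle parametrised. -/
theorem deriv_eq_intervalIntegral {f : ℂ → ℂ} {U : Set ℂ} (hU : IsOpen U)
    (hf : DifferentiableOn ℂ f U) {c w : ℂ} {r : ℝ} (hr : Metric.closedBall c r ⊆ U)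
    (hw : w ∈ Metric.ball c r) :
    deriv f w = ∫ θ in (0 : ℝ)..2 * Real.pi,
      (2 * Real.pi * Complex.I)⁻¹ * (deriv (circleMap c r) θ *
        (((circleMap c r θ - w) ^ 2)⁻¹ * f (circleMap c r θ))) := by
  rw [← Complex.two_pi_I_inv_smul_circleIntegral_sub_sq_inv_smul_of_differentiable hU hr hf hw]
  simp [circleIntegral, intervalIntegral.integral_const_mul]

/-- Cauchy's formula writes the w-derivative as an integral of F over a fixed circle, so joint
continuity passes from F to its derivative. -/
theorem continuousOn_deriv_param {X : Type*} [TopologicalSpace X] {F : ℂ → X → ℂ}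
    {U : Set ℂ} {S : Set X} (hU : IsOpen U)
    (hF : ContinuousOn (Function.uncurry F) (U ×ˢ S))
    (hd : ∀ x ∈ S, DifferentiableOn ℂ (fun w => F w x) U) :
    ContinuousOn (fun p : ℂ × X => deriv (fun w => F w p.2) p.1) (U ×ˢ S) := by
  rintro ⟨c, x₀⟩ ⟨hc, hx₀⟩
  obtain ⟨r, hr, hrU⟩ := Metric.nhds_basis_closedBall.mem_iff.1 (hU.mem_nhds hc)
  have hball : Metric.ball c r ×ˢ S ∈ 𝓝[U ×ˢ S] (c, x₀) := by
    have : Metric.ball c r ×ˢ univ ∈ 𝓝 (c, x₀) :=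
      prod_mem_nhds (Metric.ball_mem_nhds c hr) univ_mem
    filter_upwards [mem_nhdsWithin_of_mem_nhds this, self_mem_nhdsWithin] with p hp hp'
    exact ⟨hp.1, hp'.2⟩
  have key : ContinuousOn (fun p : ℂ × X => deriv (fun w => F w p.2) p.1)
      (Metric.ball c r ×ˢ S) := by
    have := continuousOn_intervalIntegral_param (X := ℂ × X) (S := Metric.ball c r ×ˢ S)
      (f := fun p θ => (2 * Real.pi * Complex.I)⁻¹ * (deriv (circleMap c r) θ *
        (((circleMap c r θ - p.1) ^ 2)⁻¹ * F (circleMap c r θ) p.2)))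
      (a := 0) (b := 2 * Real.pi) (by positivity) ?_
    · refine this.congr fun p hp => ?_
      exact deriv_eq_intervalIntegral hU (hd p.2 hp.2) hrU hp.1
    · simp only [Function.uncurry_def, deriv_circleMap]
      refine continuousOn_const.mul (ContinuousOn.mul ?_ (ContinuousOn.mul ?_ ?_))
      · have := continuous_circleMap 0 r
        fun_prop
      · refine ContinuousOn.inv₀ ?_ ?_
        · have := continuous_circleMap c r
          fun_prop
        · rintro ⟨⟨w, x⟩, θ⟩ ⟨⟨hw, -⟩, -⟩
          exact pow_ne_zero _ (sub_ne_zero.2 (circleMap_ne_mem_ball hw θ))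
      · refine hF.comp (f := fun q : (ℂ × X) × ℝ => (circleMap c r q.2, q.1.2)) ?_ ?_
        · have := continuous_circleMap c r
          fun_prop
        · rintro ⟨⟨w, x⟩, θ⟩ ⟨⟨-, hx⟩, -⟩
          exact ⟨hrU (circleMap_mem_closedBall c hr.le θ), hx⟩
  exact (key (c, x₀) ⟨Metric.mem_ball_self hr, hx₀⟩).mono_of_mem_nhdsWithin hball

/-- The mixed partials commute: the w-derivative is a Cauchy integral over a circle, and the
z-derivative is taken under that integral. -/
theorem hasDerivAt_deriv_swap {F G : ℂ → ℂ → ℂ} {U S : Set ℂ} (hU : IsOpen U) (hS : IsOpen S)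
    (hF : ContinuousOn (Function.uncurry F) (U ×ˢ S))
    (hG : ContinuousOn (Function.uncurry G) (U ×ˢ S))
    (hFd : ∀ z ∈ S, DifferentiableOn ℂ (fun w => F w z) U)
    (hGd : ∀ z ∈ S, DifferentiableOn ℂ (fun w => G w z) U)
    (hFG : ∀ w ∈ U, ∀ z ∈ S, HasDerivAt (F w) (G w z) z)
    {w z : ℂ} (hw : w ∈ U) (hz : z ∈ S) :
    HasDerivAt (fun z => deriv (fun w => F w z) w) (deriv (fun w => G w z) w) z := by
  obtain ⟨r, hr, hrU⟩ := Metric.nhds_basis_closedBall.mem_iff.1 (hU.mem_nhds hw)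
  have hcont : ∀ {F : ℂ → ℂ → ℂ}, ContinuousOn (Function.uncurry F) (U ×ˢ S) →
      ContinuousOn (Function.uncurry fun (z : ℂ) (θ : ℝ) =>
        (2 * Real.pi * Complex.I)⁻¹ * (deriv (circleMap w r) θ *
        (((circleMap w r θ - w) ^ 2)⁻¹ * F (circleMap w r θ) z)))
        (S ×ˢ Icc 0 (2 * Real.pi)) := by
    intro F hF
    simp only [Function.uncurry_def, deriv_circleMap]
    have h0 := continuous_circleMap 0 r
    have h1 := continuous_circleMap w r
    refine continuousOn_const.mul (ContinuousOn.mul (by fun_prop) (ContinuousOn.mul ?_ ?_))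
    · refine ContinuousOn.inv₀ (by fun_prop) ?_
      rintro ⟨z, θ⟩ -
      exact pow_ne_zero _ (sub_ne_zero.2 (circleMap_ne_center hr.ne'))
    · refine hF.comp (f := fun q : ℂ × ℝ => (circleMap w r q.2, q.1)) (by fun_prop) ?_
      rintro ⟨z, θ⟩ ⟨hz, -⟩
      exact ⟨hrU (circleMap_mem_closedBall w hr.le θ), hz⟩
  have key := hasDerivAt_intervalIntegral_param hS (by positivity) (hcont hF) (hcont hG)
    (fun z hz θ _ => (((hFG _ (hrU (circleMap_mem_closedBall w hr.le θ)) z hz).const_mul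
      _).const_mul _).const_mul _) hz
  rw [deriv_eq_intervalIntegral hU (hGd z hz) hrU (Metric.mem_ball_self hr)]
  refine key.congr_of_eventuallyEq ?_
  filter_upwards [hS.mem_nhds hz] with y hy
  exact deriv_eq_intervalIntegral hU (hFd y hy) hrU (Metric.mem_ball_self hr)

end ParametricIntegrals

/-! ### The Hurwitz series for Re w > 1 -/

section Series

theorem add_ofReal_mem_slitPlane {z : ℂ} (hz : z ∈ Complex.slitPlane) {τ : ℝ} (hτ : 0 ≤ τ) :
    z + τ ∈ Complex.slitPlane := by
  rw [Complex.mem_slitPlane_iff] at hz ⊢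
  rcases hz with h | h
  · left; simp; linarith
  · right; simpa using h

theorem natCast_add_mem_slitPlane {z : ℂ} (hz : z ∈ Complex.slitPlane) (n : ℕ) :
    (n : ℂ) + z ∈ Complex.slitPlane := by
  have := add_ofReal_mem_slitPlane hz (τ := n) n.cast_nonneg
  rwa [Complex.ofReal_natCast, add_comm] at this

/-- Linear growth of |x + τ|, uniform for x near z, is what bounds the terms of the series locally
uniformly. -/
theorem exists_mul_one_add_le_norm_add {z : ℂ} (hz : z ∈ Complex.slitPlane) :
    ∃ c > 0, c ≤ 1 ∧ ∀ x ∈ Metric.ball z c, ∀ τ : ℝ, 0 ≤ τ → c * (1 + τ) ≤ ‖x + τ‖ := by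
  obtain ⟨d, hd, hdz⟩ : ∃ d > 0, ∀ τ : ℝ, 0 ≤ τ → d ≤ ‖z + τ‖ := by
    rcases Complex.mem_slitPlane_iff.1 hz with h | h
    · refine ⟨z.re, h, fun τ hτ => ?_⟩
      have := Complex.re_le_norm (z + τ)
      simp at this
      linarith
    · refine ⟨|z.im|, abs_pos.2 h, fun τ hτ => ?_⟩
      simpa using Complex.abs_im_le_norm (z + τ)
  -- With d a lower bound for |z + τ|, 1 + τ ≤ |z + τ| + (1 + |z|) ≤ q |z + τ|. Halving 1/q below
  -- pays for moving z to x.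
  set q : ℝ := 1 + (1 + ‖z‖) / d with hq
  have hq1 : 1 ≤ q := by rw [hq]; have : 0 ≤ (1 + ‖z‖) / d := by positivity
                         linarith
  have hz' : ∀ τ : ℝ, 0 ≤ τ → q⁻¹ * (1 + τ) ≤ ‖z + τ‖ := by
    intro τ hτ
    rw [inv_mul_le_iff₀ (by linarith)]
    have h1 : τ ≤ ‖z + τ‖ + ‖z‖ := by
      have := norm_sub_le (z + τ) z
      simp only [add_sub_cancel_left, Complex.norm_real, Real.norm_of_nonneg hτ] at this
      exact this
    have h2 : (1 + ‖z‖) ≤ (1 + ‖z‖) / d * ‖z + τ‖ := by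
      rw [div_mul_eq_mul_div, le_div_iff₀ hd]
      exact mul_le_mul_of_nonneg_left (hdz τ hτ) (by positivity)
    rw [hq, add_mul]
    linarith
  have hqi : q⁻¹ ≤ 1 := inv_le_one_of_one_le₀ hq1
  have hqp : 0 < q⁻¹ := by positivity
  refine ⟨q⁻¹ / 2, by positivity, by linarith, fun x hx τ hτ => ?_⟩
  have h1 := hz' τ hτ
  have h2 : ‖z + τ‖ ≤ ‖x + τ‖ + ‖x - z‖ := by
    have := norm_sub_le (x + τ) (x - z)
    rwa [show x + τ - (x - z) = z + τ by ring] at this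
  rw [mem_ball_iff_norm] at hx
  nlinarith

/-- Weierstrass majorant, uniform in both variables: |a^{-w}| = |a|^{-Re w} e^{arg(a) Im w} with
|arg a| ≤ π. -/
theorem exists_summable_bound {w₀ z₀ : ℂ} (hw₀ : 1 < w₀.re) (hz₀ : z₀ ∈ Complex.slitPlane) :
    ∃ r > 0, ∃ u : ℕ → ℝ, Summable u ∧ (∀ w ∈ Metric.ball w₀ r, 1 < w.re) ∧
      Metric.ball z₀ r ⊆ Complex.slitPlane ∧
      ∀ w ∈ Metric.ball w₀ r, ∀ x ∈ Metric.ball z₀ r, ∀ n : ℕ,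
        ‖((n : ℂ) + x) ^ (-w)‖ ≤ u n := by
  obtain ⟨c, hc, hc1, hcx⟩ := exists_mul_one_add_le_norm_add hz₀
  obtain ⟨r', hr', hr'S⟩ := Metric.isOpen_iff.1 Complex.isOpen_slitPlane z₀ hz₀
  -- Half the distance to the line Re w = 1, so that the exponent Re w₀ - δ still exceeds 1.
  set δ : ℝ := (w₀.re - 1) / 2 with hδ
  have hδ0 : 0 < δ := by rw [hδ]; linarith
  set r := min c (min r' δ) with hr
  have hrc : r ≤ c := min_le_left _ _
  have hrr : r ≤ r' := (min_le_right _ _).trans (min_le_left _ _)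
  have hrδ : r ≤ δ := (min_le_right _ _).trans (min_le_right _ _)
  have hre : ∀ w ∈ Metric.ball w₀ r, |w.re - w₀.re| < δ := fun w hw => by
    rw [mem_ball_iff_norm] at hw
    have := Complex.abs_re_le_norm (w - w₀)
    rw [Complex.sub_re] at this
    linarith
  have him : ∀ w ∈ Metric.ball w₀ r, |w.im - w₀.im| < δ := fun w hw => by
    rw [mem_ball_iff_norm] at hw
    have := Complex.abs_im_le_norm (w - w₀)
    rw [Complex.sub_im] at this
    linarith
  refine ⟨r, by positivity, fun n => Real.exp (Real.pi * (|w₀.im| + δ)) *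
    (c ^ (-(w₀.re + δ)) * ((n : ℝ) + 1) ^ (-(w₀.re - δ))), ?_, ?_, ?_, ?_⟩
  · refine Summable.mul_left _ (Summable.mul_left _ ?_)
    have : Summable fun n : ℕ => ((n : ℝ)) ^ (-(w₀.re - δ)) :=
      Real.summable_nat_rpow.2 (by rw [hδ]; linarith)
    simpa using (summable_nat_add_iff 1).2 this
  · intro w hw
    have := (abs_lt.1 (hre w hw)).1
    linarith
  · exact (Metric.ball_subset_ball hrr).trans hr'S
  · intro w hw x hx n
    have hw1 := abs_lt.1 (hre w hw)
    have hw2 := abs_lt.1 (him w hw)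
    have hn := hcx x (Metric.ball_subset_ball hrc hx) n n.cast_nonneg
    rw [Complex.ofReal_natCast, add_comm x] at hn
    have hn0 : (0 : ℝ) ≤ n := n.cast_nonneg
    have hpos : 0 < c * (1 + n) := by positivity
    have hne : (n : ℂ) + x ≠ 0 := norm_pos_iff.1 (hpos.trans_le hn)
    rw [Complex.norm_cpow_of_ne_zero hne, div_eq_mul_inv, mul_comm, ← Real.exp_neg]
    refine mul_le_mul ?_ ?_ (by positivity) (by positivity)
    · refine Real.exp_le_exp.2 ?_
      have h1 := Complex.abs_arg_le_pi ((n : ℂ) + x)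
      have h2 : |w.im| ≤ |w₀.im| + δ := by
        have := abs_sub_abs_le_abs_sub w.im w₀.im
        have := him w hw
        linarith
      calc -(Complex.arg (n + x) * (-w).im) ≤ |Complex.arg (n + x) * w.im| := by
            simpa using le_abs_self (Complex.arg (n + x) * w.im)
        _ = |Complex.arg (n + x)| * |w.im| := abs_mul _ _
        _ ≤ _ := mul_le_mul h1 h2 (abs_nonneg _) Real.pi_nonneg
    · rw [Complex.neg_re]
      calc ‖(n : ℂ) + x‖ ^ (-w.re) ≤ (c * (1 + n)) ^ (-w.re) :=
            Real.rpow_le_rpow_of_nonpos hpos hn (by linarith)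
        _ = c ^ (-w.re) * ((n : ℝ) + 1) ^ (-w.re) := by
            rw [Real.mul_rpow hc.le (by positivity), add_comm]
        _ ≤ _ := by
            refine mul_le_mul ?_ ?_ (by positivity) (by positivity)
            · exact Real.rpow_le_rpow_of_exponent_ge hc hc1 (by linarith)
            · exact Real.rpow_le_rpow_of_exponent_le (by linarith) (by linarith)

/-- The series defining the Hurwitz zeta function for `1 < re w`. -/
noncomputable def zetaSeries (w z : ℂ) : ℂ := ∑' n : ℕ, ((n : ℂ) + z) ^ (-w)

theorem summable_zetaSeries {w z : ℂ} (hw : 1 < w.re) (hz : z ∈ Complex.slitPlane) :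
    Summable fun n : ℕ => ((n : ℂ) + z) ^ (-w) := by
  obtain ⟨r, hr, u, hu, -, -, h⟩ := exists_summable_bound hw hz
  exact .of_norm_bounded hu (h w (Metric.mem_ball_self hr) z (Metric.mem_ball_self hr))

theorem zetaSeries_eq_add {w z : ℂ} (hw : 1 < w.re) (hz : z ∈ Complex.slitPlane) :
    zetaSeries w z = z ^ (-w) + zetaSeries w (z + 1) := by
  rw [zetaSeries, (summable_zetaSeries hw hz).tsum_eq_zero_add, zetaSeries]
  simp [add_assoc, add_comm z 1]

theorem continuousOn_zetaSeries :
    ContinuousOn (Function.uncurry zetaSeries) ({w | 1 < w.re} ×ˢ Complex.slitPlane) := by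
  rintro ⟨w, z⟩ ⟨hw, hz⟩
  obtain ⟨r, hr, u, hu, hre, hS, h⟩ := exists_summable_bound hw hz
  have hc : ContinuousOn (Function.uncurry zetaSeries) (Metric.ball w r ×ˢ Metric.ball z r) := by
    refine continuousOn_tsum (fun n => ?_) hu fun n p hp => h p.1 hp.1 p.2 hp.2 n
    refine ContinuousOn.cpow (by fun_prop) (by fun_prop) fun p hp => ?_
    exact natCast_add_mem_slitPlane (hS hp.2) n
  exact (hc.continuousAt (prod_mem_nhds (Metric.ball_mem_nhds _ hr)
    (Metric.ball_mem_nhds _ hr))).continuousWithinAt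

theorem differentiableAt_zetaSeries {w z : ℂ} (hw : 1 < w.re) (hz : z ∈ Complex.slitPlane) :
    DifferentiableAt ℂ (fun w => zetaSeries w z) w := by
  obtain ⟨r, hr, u, hu, hre, hS, h⟩ := exists_summable_bound hw hz
  refine (Complex.differentiableOn_tsum_of_summable_norm hu (fun n => ?_) Metric.isOpen_ball
    fun n w hw => h w hw z (Metric.mem_ball_self hr) n).differentiableAt
    (Metric.ball_mem_nhds _ hr)
  have : (n : ℂ) + z ≠ 0 := Complex.slitPlane_ne_zero (natCast_add_mem_slitPlane hz n)
  exact DifferentiableOn.const_cpow (by fun_prop) (Or.inl this)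

theorem hasDerivAt_zetaSeries {w z : ℂ} (hw : 1 < w.re) (hz : z ∈ Complex.slitPlane) :
    HasDerivAt (zetaSeries w) (-w * zetaSeries (w + 1) z) z := by
  obtain ⟨r, hr, u, hu, hre, hS, h⟩ := exists_summable_bound hw hz
  have hn : ∀ n : ℕ, ∀ x ∈ Metric.ball z r,
      HasDerivAt (fun x => ((n : ℂ) + x) ^ (-w)) (-w * ((n : ℂ) + x) ^ (-(w + 1))) x := by
    intro n x hx
    have := ((hasDerivAt_id x).const_add (n : ℂ)).cpow_const (c := -w)
      (natCast_add_mem_slitPlane (hS hx) n)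
    simpa [neg_add, sub_eq_add_neg, add_comm] using this
  have hd : ∀ n : ℕ, DifferentiableOn ℂ (fun x => ((n : ℂ) + x) ^ (-w)) (Metric.ball z r) :=
    fun n x hx => (hn n x hx).differentiableAt.differentiableWithinAt
  have hb := fun (n : ℕ) x hx => h w (Metric.mem_ball_self hr) x hx n
  have hzr := Metric.mem_ball_self (x := z) hr
  have h1 := (Complex.differentiableOn_tsum_of_summable_norm hu hd Metric.isOpen_ball
    hb).differentiableAt (Metric.ball_mem_nhds _ hr)
  have h2 := Complex.hasSum_deriv_of_summable_norm hu hd Metric.isOpen_ball hb hzr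
  have h3 := h1.hasDerivAt
  rw [← h2.tsum_eq] at h3
  simp_rw [fun n : ℕ => (hn n z hzr).deriv, tsum_mul_left] at h3
  exact h3

end Series

/-! ### Analytic continuation of (w - 1) ζ(w, z) -/

section Continuation

/-- The right half plane `1 - K < re w`. -/
def rightHalfPlane (K : ℕ) : Set ℂ := {w | 1 - (K : ℝ) < w.re}

theorem isOpen_rightHalfPlane (K : ℕ) : IsOpen (rightHalfPlane K) :=
  isOpen_lt continuous_const Complex.continuous_re

theorem add_one_mem_rightHalfPlane {K : ℕ} {w : ℂ} (hw : w ∈ rightHalfPlane (K + 1)) :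
    w + 1 ∈ rightHalfPlane K := by
  simp only [rightHalfPlane, mem_ofPred_eq, Nat.cast_add, Nat.cast_one, Complex.add_re,
    Complex.one_re] at hw ⊢
  linarith

theorem rightHalfPlane_mono {K L : ℕ} (h : K ≤ L) : rightHalfPlane K ⊆ rightHalfPlane L := by
  intro w hw
  have : (K : ℝ) ≤ L := by exact_mod_cast h
  simp only [rightHalfPlane, mem_ofPred_eq] at hw ⊢
  linarith

theorem add_one_mem_rightHalfPlane_self {K : ℕ} {w : ℂ} (hw : w ∈ rightHalfPlane K) :
    w + 1 ∈ rightHalfPlane K := by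
  simp only [rightHalfPlane, mem_ofPred_eq, Complex.add_re, Complex.one_re] at hw ⊢
  linarith

/-- Continuation of `(w - 1) ζ(w, z)` to `1 - K < re w`, one strip at a time. -/
noncomputable def regZetaAux : ℕ → ℂ → ℂ → ℂ
  | 0, w, z => (w - 1) * zetaSeries w z
  | K + 1, w, z => z ^ (1 - w) +
      (w - 1) * ∫ v in (0 : ℝ)..1, (1 - (v : ℂ)) * regZetaAux K (w + 1) (z + v)

theorem regZetaAux_succ (K : ℕ) (w z : ℂ) : regZetaAux (K + 1) w z = z ^ (1 - w) +
      (w - 1) * ∫ v in (0 : ℝ)..1, (1 - (v : ℂ)) * regZetaAux K (w + 1) (z + v) := rfl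

/-- The three properties are proved together: holomorphy in w at the next stage needs joint
continuity of the w-derivative, which `continuousOn_deriv_param` draws from the first two. -/
theorem regZetaAux_properties (K : ℕ) :
    ContinuousOn (Function.uncurry (regZetaAux K)) (rightHalfPlane K ×ˢ Complex.slitPlane) ∧
    (∀ z ∈ Complex.slitPlane,
      DifferentiableOn ℂ (fun w => regZetaAux K w z) (rightHalfPlane K)) ∧
    (∀ w ∈ rightHalfPlane K, ∀ z ∈ Complex.slitPlane,
      HasDerivAt (regZetaAux K w) ((1 - w) * regZetaAux K (w + 1) z) z) := by
  induction K with
  | zero =>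
    have h0 : rightHalfPlane 0 = {w | 1 < w.re} := by simp [rightHalfPlane]
    rw [h0]
    refine ⟨?_, fun z hz w hw => ?_, fun w hw z hz => ?_⟩
    · refine ContinuousOn.mul (by fun_prop) continuousOn_zetaSeries
    · refine DifferentiableAt.differentiableWithinAt ?_
      have := differentiableAt_zetaSeries hw hz
      simp only [regZetaAux]
      fun_prop
    · have := (hasDerivAt_zetaSeries hw hz).const_mul (w - 1)
      simp only [regZetaAux]
      refine this.congr_deriv ?_
      ring
  | succ K ih =>
    obtain ⟨hc, hd, hz'⟩ := ih
    have hdc := continuousOn_deriv_param (isOpen_rightHalfPlane K) hc hd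
    refine ⟨?_, fun z hz w hw => ?_, fun w hw z hz => ?_⟩
    · have key := continuousOn_intervalIntegral_param (a := 0) (b := 1)
        (S := rightHalfPlane (K + 1) ×ˢ Complex.slitPlane)
        (f := fun (p : ℂ × ℂ) v => (1 - (v : ℂ)) * regZetaAux K (p.1 + 1) (p.2 + v)) zero_le_one ?_
      · simp only [Function.uncurry_def, regZetaAux_succ]
        refine ContinuousOn.add (ContinuousOn.cpow (by fun_prop) (by fun_prop) fun p hp => hp.2)
          (ContinuousOn.mul (by fun_prop) key)
      · refine ContinuousOn.mul (by fun_prop) ?_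
        refine hc.comp (f := fun q : (ℂ × ℂ) × ℝ => (q.1.1 + 1, q.1.2 + (q.2 : ℂ)))
          (by fun_prop) ?_
        rintro ⟨⟨w, z⟩, v⟩ ⟨⟨hw, hz⟩, hv⟩
        exact ⟨add_one_mem_rightHalfPlane hw, add_ofReal_mem_slitPlane hz hv.1⟩
    · refine DifferentiableAt.differentiableWithinAt ?_
      have hmaps : MapsTo (fun q : ℂ × ℝ => (q.1 + 1, z + (q.2 : ℂ)))
          (rightHalfPlane (K + 1) ×ˢ Icc 0 1) (rightHalfPlane K ×ˢ Complex.slitPlane) :=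
        fun q hq => ⟨add_one_mem_rightHalfPlane hq.1, add_ofReal_mem_slitPlane hz hq.2.1⟩
      have key := hasDerivAt_intervalIntegral_param (isOpen_rightHalfPlane (K + 1))
        (a := 0) (b := 1) zero_le_one
        (f := fun w v => (1 - (v : ℂ)) * regZetaAux K (w + 1) (z + v))
        (f' := fun w v => (1 - (v : ℂ)) * deriv (fun w => regZetaAux K w (z + v)) (w + 1))
        (ContinuousOn.mul (by fun_prop) (hc.comp
          (f := fun q : ℂ × ℝ => (q.1 + 1, z + (q.2 : ℂ))) (by fun_prop) hmaps))
        (ContinuousOn.mul (by fun_prop) (hdc.comp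
          (f := fun q : ℂ × ℝ => (q.1 + 1, z + (q.2 : ℂ))) (by fun_prop) hmaps))
        (fun w hw v hv => by
          have := ((hd _ (add_ofReal_mem_slitPlane hz hv.1)).differentiableAt
            ((isOpen_rightHalfPlane K).mem_nhds (add_one_mem_rightHalfPlane hw))).hasDerivAt
          exact (this.comp_add_const w 1).const_mul _) hw
      simp only [regZetaAux_succ]
      have hz0 := Complex.slitPlane_ne_zero hz
      have h1 : DifferentiableAt ℂ (fun w : ℂ => z ^ (1 - w)) w :=
        DifferentiableAt.const_cpow (by fun_prop) (Or.inl hz0)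
      exact h1.add (DifferentiableAt.mul (by fun_prop) key.differentiableAt)
    · have hw1 := add_one_mem_rightHalfPlane hw
      have hw2 := add_one_mem_rightHalfPlane_self hw1
      have hF : ∀ w ∈ rightHalfPlane K, ContinuousOn (Function.uncurry fun (z : ℂ) (v : ℝ) =>
          (1 - (v : ℂ)) * regZetaAux K w (z + v)) (Complex.slitPlane ×ˢ Icc 0 1) := by
        intro w hw
        refine ContinuousOn.mul (by fun_prop) (hc.comp
          (f := fun q : ℂ × ℝ => (w, q.1 + (q.2 : ℂ))) (by fun_prop) ?_)
        exact fun q hq => ⟨hw, add_ofReal_mem_slitPlane hq.1 hq.2.1⟩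
      have key := hasDerivAt_intervalIntegral_param Complex.isOpen_slitPlane
        (a := 0) (b := 1) zero_le_one
        (f := fun z v => (1 - (v : ℂ)) * regZetaAux K (w + 1) (z + v))
        (f' := fun z v => -w * ((1 - (v : ℂ)) * regZetaAux K (w + 1 + 1) (z + v)))
        (hF _ hw1) (continuousOn_const.mul (hF _ hw2))
        (fun z hz v hv => by
          have := ((hz' _ hw1 _ (add_ofReal_mem_slitPlane hz hv.1)).comp_add_const z v).const_mul
            (1 - (v : ℂ))
          refine this.congr_deriv ?_
          ring) hz
      have h1 : HasDerivAt (fun z : ℂ => z ^ (1 - w)) ((1 - w) * z ^ (1 - (w + 1))) z := by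
        have := (hasDerivAt_id z).cpow_const (c := 1 - w) hz
        simpa [show 1 - w - 1 = 1 - (w + 1) by ring] using this
      have h2 : regZetaAux (K + 1) w = fun z => z ^ (1 - w) +
        (w - 1) * ∫ v in (0 : ℝ)..1, (1 - (v : ℂ)) * regZetaAux K (w + 1) (z + v) := rfl
      rw [h2]
      refine (h1.add (key.const_mul (w - 1))).congr_deriv ?_
      rw [regZetaAux_succ, intervalIntegral.integral_const_mul]
      ring

/-- Integration by parts in v, using ∂_v ζ(w, z + v) = -w ζ(w + 1, z + v); the boundary terms
collapse by ζ(w - 1, z) = z^{1-w} + ζ(w - 1, z + 1). The primitive involves ζ(w - 1, ·), whence Re w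
> 2. -/
theorem regZetaAux_one_eq_of_two_lt {w z : ℂ} (hw : 2 < w.re) (hz : z ∈ Complex.slitPlane) :
    regZetaAux 1 w z = regZetaAux 0 w z := by
  have hdv : ∀ s : ℂ, 1 < s.re → ∀ v ∈ uIcc (0 : ℝ) 1,
      HasDerivAt (fun v : ℝ => zetaSeries s (z + v)) (-s * zetaSeries (s + 1) (z + v)) v := by
    intro s hs v hv
    rw [uIcc_of_le zero_le_one] at hv
    exact ((hasDerivAt_zetaSeries hs (add_ofReal_mem_slitPlane hz hv.1)).comp_const_add
      z (v : ℂ)).comp_ofReal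
  have h1 : 1 < w.re := by linarith
  have hw' : 1 < (w - 1).re := by simp; linarith
  have hw1 : 1 < (w + 1).re := by simp; linarith
  have hint : IntervalIntegrable
      (fun v : ℝ => (1 - (v : ℂ)) * ((w + 1 - 1) * zetaSeries (w + 1) (z + v))) volume 0 1 := by
    refine ContinuousOn.intervalIntegrable fun v hv => ?_
    have := (hdv (w + 1) hw1 v hv).continuousAt
    refine ContinuousAt.continuousWithinAt ?_
    fun_prop
  have key := intervalIntegral.integral_eq_sub_of_hasDerivAt (a := 0) (b := 1)
    (f := fun v : ℝ => -((w - 1) * ((1 - (v : ℂ)) * zetaSeries w (z + v))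
      - zetaSeries (w - 1) (z + v)))
    (f' := fun v : ℝ => (w - 1) *
      ((1 - (v : ℂ)) * ((w + 1 - 1) * zetaSeries (w + 1) (z + v))))
    (fun v hv => by
      have ha : HasDerivAt (fun v : ℝ => 1 - (v : ℂ)) (-1) v := by
        simpa using (Complex.ofRealCLM.hasDerivAt (x := v)).const_sub 1
      refine (((ha.mul (hdv w h1 v hv)).const_mul (w - 1)).sub
        (hdv (w - 1) hw' v hv)).neg.congr_deriv ?_
      rw [show w - 1 + 1 = w by ring]
      ring) (hint.const_mul _)
  rw [intervalIntegral.integral_const_mul] at key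
  rw [regZetaAux_succ]
  simp only [regZetaAux]
  rw [key]
  simp only [Complex.ofReal_one, Complex.ofReal_zero, add_zero]
  rw [zetaSeries_eq_add hw' hz, show -(w - 1) = 1 - w by ring]
  ring

/-- Only the first stage needs the identity theorem, to pass from Re w > 2 to Re w > 1; later stages
inherit the equality through the recursion. -/
theorem regZetaAux_succ_eq (K : ℕ) {w z : ℂ} (hw : w ∈ rightHalfPlane K)
    (hz : z ∈ Complex.slitPlane) : regZetaAux (K + 1) w z = regZetaAux K w z := by
  induction K generalizing w z with
  | zero =>
    have h0 := ((regZetaAux_properties 0).2.1 z hz).analyticOnNhd (isOpen_rightHalfPlane 0)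
    have h1 := (((regZetaAux_properties 1).2.1 z hz).mono
      (rightHalfPlane_mono zero_le_one)).analyticOnNhd (isOpen_rightHalfPlane 0)
    have hconn : IsPreconnected (rightHalfPlane 0) := (convex_halfSpace_re_gt _).isPreconnected
    refine h1.eqOn_of_preconnected_of_eventuallyEq h0 hconn (z₀ := 3) ?_ ?_ hw
    · simp [rightHalfPlane]
    · have : {w : ℂ | 2 < w.re} ∈ 𝓝 (3 : ℂ) :=
        (isOpen_lt continuous_const Complex.continuous_re).mem_nhds (by simp; norm_num)
      filter_upwards [this] with w hw using regZetaAux_one_eq_of_two_lt hw hz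
  | succ K ih =>
    rw [regZetaAux_succ, regZetaAux_succ]
    congr 2
    refine intervalIntegral.integral_congr fun v hv => ?_
    rw [uIcc_of_le zero_le_one] at hv
    rw [ih (add_one_mem_rightHalfPlane hw) (add_ofReal_mem_slitPlane hz hv.1)]

theorem regZetaAux_eq_of_le {K L : ℕ} (h : K ≤ L) {w z : ℂ} (hw : w ∈ rightHalfPlane K)
    (hz : z ∈ Complex.slitPlane) : regZetaAux L w z = regZetaAux K w z := by
  induction L, h using Nat.le_induction with
  | base => rfl
  | succ L hL ih => rw [regZetaAux_succ_eq L (rightHalfPlane_mono hL hw) hz, ih]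

/-- The entire function `w ↦ (w - 1) ζ(w, z)`. -/
noncomputable def regZeta (w z : ℂ) : ℂ := regZetaAux (⌈1 - w.re⌉₊ + 1) w z

theorem regZeta_eq {K : ℕ} {w z : ℂ} (hw : w ∈ rightHalfPlane K) (hz : z ∈ Complex.slitPlane) :
    regZeta w z = regZetaAux K w z := by
  have hw' : w ∈ rightHalfPlane (⌈1 - w.re⌉₊ + 1) := by
    have := Nat.le_ceil (1 - w.re)
    simp only [rightHalfPlane, mem_ofPred_eq, Nat.cast_add, Nat.cast_one]
    linarith
  rcases le_total K (⌈1 - w.re⌉₊ + 1) with h | h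
  · exact regZetaAux_eq_of_le h hw hz
  · exact (regZetaAux_eq_of_le h hw' hz).symm

theorem exists_mem_rightHalfPlane (w : ℂ) : ∃ K, w ∈ rightHalfPlane K := by
  obtain ⟨K, hK⟩ := exists_nat_gt (1 - w.re)
  refine ⟨K, ?_⟩
  simp only [rightHalfPlane, mem_ofPred_eq]
  linarith

theorem continuousOn_regZeta :
    ContinuousOn (Function.uncurry regZeta) (univ ×ˢ Complex.slitPlane) := by
  rintro ⟨w, z⟩ ⟨-, hz⟩
  obtain ⟨K, hK⟩ := exists_mem_rightHalfPlane w
  have hmem : rightHalfPlane K ×ˢ Complex.slitPlane ∈ 𝓝 (w, z) :=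
    prod_mem_nhds ((isOpen_rightHalfPlane K).mem_nhds hK) (Complex.isOpen_slitPlane.mem_nhds hz)
  refine ContinuousAt.continuousWithinAt ?_
  refine ((regZetaAux_properties K).1.continuousAt hmem).congr ?_
  filter_upwards [hmem] with p hp using (regZeta_eq hp.1 hp.2).symm

theorem differentiable_regZeta {z : ℂ} (hz : z ∈ Complex.slitPlane) :
    Differentiable ℂ (fun w => regZeta w z) := by
  intro w
  obtain ⟨K, hK⟩ := exists_mem_rightHalfPlane w
  have hmem := (isOpen_rightHalfPlane K).mem_nhds hK
  refine (((regZetaAux_properties K).2.1 z hz).differentiableAt hmem).congr_of_eventuallyEq ?_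
  filter_upwards [hmem] with w hw using regZeta_eq hw hz

theorem hasDerivAt_regZeta (w : ℂ) {z : ℂ} (hz : z ∈ Complex.slitPlane) :
    HasDerivAt (regZeta w) ((1 - w) * regZeta (w + 1) z) z := by
  obtain ⟨K, hK⟩ := exists_mem_rightHalfPlane w
  rw [regZeta_eq (add_one_mem_rightHalfPlane_self hK) hz]
  refine ((regZetaAux_properties K).2.2 w hK z hz).congr_of_eventuallyEq ?_
  filter_upwards [Complex.isOpen_slitPlane.mem_nhds hz] with y hy using regZeta_eq hK hy

theorem regZeta_eq_zetaSeries {w z : ℂ} (hw : 1 < w.re) (hz : z ∈ Complex.slitPlane) :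
    regZeta w z = (w - 1) * zetaSeries w z :=
  regZeta_eq (K := 0) (by simpa [rightHalfPlane] using hw) hz

theorem regZeta_eq_integral (w : ℂ) {z : ℂ} (hz : z ∈ Complex.slitPlane) :
    regZeta w z = z ^ (1 - w) +
      (w - 1) * ∫ v in (0 : ℝ)..1, (1 - (v : ℂ)) * regZeta (w + 1) (z + v) := by
  obtain ⟨K, hK⟩ := exists_mem_rightHalfPlane w
  have hK' := rightHalfPlane_mono K.le_succ hK
  rw [regZeta_eq hK' hz, regZetaAux_succ]
  congr 2
  refine intervalIntegral.integral_congr fun v hv => ?_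
  rw [uIcc_of_le zero_le_one] at hv
  rw [regZeta_eq (add_one_mem_rightHalfPlane hK') (add_ofReal_mem_slitPlane hz hv.1)]

/-- Splitting off the first term of the series is valid for Re w > 1, and both sides are entire in
w. -/
theorem regZeta_eq_add (w : ℂ) {z : ℂ} (hz : z ∈ Complex.slitPlane) :
    regZeta w z = (w - 1) * z ^ (-w) + regZeta w (z + 1) := by
  have hz0 := Complex.slitPlane_ne_zero hz
  have hz1 : z + 1 ∈ Complex.slitPlane := by simpa using add_ofReal_mem_slitPlane hz zero_le_one
  have h1 : Differentiable ℂ fun w => (w - 1) * z ^ (-w) + regZeta w (z + 1) := by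
    have h := differentiable_regZeta hz1
    have : Differentiable ℂ fun w : ℂ => z ^ (-w) := fun w =>
      DifferentiableAt.const_cpow (by fun_prop) (Or.inl hz0)
    fun_prop
  have hA : ∀ {f : ℂ → ℂ}, Differentiable ℂ f → AnalyticOnNhd ℂ f univ := fun h =>
    h.differentiableOn.analyticOnNhd isOpen_univ
  refine (hA (differentiable_regZeta hz)).eqOn_of_preconnected_of_eventuallyEq (hA h1)
    isPreconnected_univ (mem_univ (2 : ℂ)) ?_ (mem_univ w)
  have : {w : ℂ | 1 < w.re} ∈ 𝓝 (2 : ℂ) :=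
    (isOpen_lt continuous_const Complex.continuous_re).mem_nhds (by simp)
  filter_upwards [this] with w hw
  rw [regZeta_eq_zetaSeries hw hz, regZeta_eq_zetaSeries hw hz1, zetaSeries_eq_add hw hz]
  ring

theorem isHurwitzContinuation_regZeta {z : ℂ} (hz : z ∈ Complex.slitPlane) :
    IsHurwitzContinuation z fun w => regZeta w z / (w - 1) := by
  refine ⟨fun w hw => ?_, fun w hw => ?_⟩
  · have h1 : DifferentiableAt ℂ (fun w : ℂ => w - 1) w := by fun_prop
    have hw1 : w - 1 ≠ 0 := sub_ne_zero.2 hw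
    exact ((differentiable_regZeta hz w).fun_div h1 hw1).differentiableWithinAt
  · have hw1 : w - 1 ≠ 0 := by
      rintro h
      rw [sub_eq_zero] at h
      simp [h] at hw
    beta_reduce
    rw [regZeta_eq_zetaSeries hw hz, mul_div_cancel_left₀ _ hw1]
    exact (summable_zetaSeries hw hz).hasSum

/-- The constructed continuation shows that the choice in `hurwitzZeta` is not vacuous;
connectedness of ℂ ∖ {1} makes it unique there. -/
theorem hurwitzZeta_eq {z : ℂ} (hz : z ∈ Complex.slitPlane) {w : ℂ} (hw : w ≠ 1) :
    hurwitzZeta z w = regZeta w z / (w - 1) := by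
  have h1 := isHurwitzContinuation_regZeta hz
  have h2 : IsHurwitzContinuation z (hurwitzZeta z) := Classical.epsilon_spec ⟨_, h1⟩
  have hconn : IsPreconnected ({1}ᶜ : Set ℂ) :=
    (isConnected_compl_singleton_of_one_lt_rank (by simp) _).isPreconnected
  refine (h2.1.analyticOnNhd isOpen_compl_singleton).eqOn_of_preconnected_of_eventuallyEq
    (h1.1.analyticOnNhd isOpen_compl_singleton) hconn (z₀ := 2) (by simp) ?_ hw
  have : {w : ℂ | 1 < w.re} ∈ 𝓝 (2 : ℂ) :=
    (isOpen_lt continuous_const Complex.continuous_re).mem_nhds (by simp)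
  filter_upwards [this] with w hw using (h2.2 w hw).unique (h1.2 w hw)

end Continuation

/-! ### Bernoulli polynomials at complex arguments -/

section Bernoulli

theorem bernoulliValue_zero (z : ℂ) : bernoulliValue 0 z = 1 := by simp [bernoulliValue]

theorem bernoulliValue_add_one (n : ℕ) (z : ℂ) :
    bernoulliValue n (z + 1) = bernoulliValue n z + n * z ^ (n - 1) := by
  have := congrArg (aeval z) (bernoulli_comp_one_add_X n)
  rw [aeval_comp] at this
  simpa [bernoulliValue, add_comm] using this

theorem hasDerivAt_bernoulliValue (n : ℕ) (z : ℂ) :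
    HasDerivAt (bernoulliValue n) (n * bernoulliValue (n - 1) z) z := by
  have := (Polynomial.bernoulli n).hasDerivAt_aeval z
  refine this.congr_deriv ?_
  simp [bernoulliValue, derivative_bernoulli]

end Bernoulli

/-! ### Values at w = 1 - k and the derivatives of log 𝒢_k -/

section SpecialValues

/-- The Bernoulli polynomials obey the integral recursion too: integration by parts and B_{k+2}(z +
1) - B_{k+2}(z) = (k + 2) z^{k+1}. At k = 0 the factor w - 1 kills the integral. -/
theorem regZeta_one_sub_natCast (k : ℕ) {z : ℂ} (hz : z ∈ Complex.slitPlane) :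
    regZeta (1 - k) z = bernoulliValue k z := by
  induction k generalizing z with
  | zero =>
    rw [regZeta_eq_integral _ hz]
    simp [bernoulliValue_zero]
  | succ k ih =>
    have hB : ∀ (n : ℕ) (v : ℝ), HasDerivAt (fun v : ℝ => bernoulliValue n (z + v))
        (n * bernoulliValue (n - 1) (z + v)) v := fun n v =>
      ((hasDerivAt_bernoulliValue n (z + v)).comp_const_add z (v : ℂ)).comp_ofReal
    have hk1 : (k : ℂ) + 1 ≠ 0 := by exact_mod_cast k.succ_ne_zero
    have hk2 : (k : ℂ) + 2 ≠ 0 := by exact_mod_cast (k + 1).succ_ne_zero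
    have hcont : Continuous fun v : ℝ => bernoulliValue k (z + v) :=
      continuous_iff_continuousAt.2 fun v => (hB k v).continuousAt
    have key := intervalIntegral.integral_eq_sub_of_hasDerivAt (a := 0) (b := 1)
      (f := fun v : ℝ => -((1 - (v : ℂ)) * bernoulliValue (k + 1) (z + v)
        + bernoulliValue (k + 2) (z + v) / (k + 2)))
      (f' := fun v : ℝ => -((k : ℂ) + 1) * ((1 - (v : ℂ)) * bernoulliValue k (z + v)))
      (fun v _ => by
        have ha : HasDerivAt (fun v : ℝ => 1 - (v : ℂ)) (-1) v := by
          simpa using (Complex.ofRealCLM.hasDerivAt (x := v)).const_sub 1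
        refine ((ha.mul (hB (k + 1) v)).add ((hB (k + 2) v).div_const _)).neg.congr_deriv ?_
        simp only [Nat.add_sub_cancel, show k + 2 - 1 = k + 1 from rfl]
        push_cast
        field_simp
        ring)
      (Continuous.intervalIntegrable (by fun_prop) _ _)
    rw [intervalIntegral.integral_const_mul] at key
    rw [regZeta_eq_integral _ hz]
    have hint : ∫ v in (0 : ℝ)..1, (1 - (v : ℂ)) * regZeta (1 - ((k + 1 : ℕ) : ℂ) + 1) (z + v)
        = ∫ v in (0 : ℝ)..1, (1 - (v : ℂ)) * bernoulliValue k (z + v) := by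
      refine intervalIntegral.integral_congr fun v hv => ?_
      rw [uIcc_of_le zero_le_one] at hv
      simp only [Nat.cast_add, Nat.cast_one]
      rw [show 1 - ((k : ℂ) + 1) + 1 = 1 - k by ring, ih (add_ofReal_mem_slitPlane hz hv.1)]
    rw [hint, show (1 - ((k + 1 : ℕ) : ℂ) - 1) = -((k : ℂ) + 1) by push_cast; ring, key,
      show (1 - (1 - ((k + 1 : ℕ) : ℂ))) = ((k + 1 : ℕ) : ℂ) by ring, Complex.cpow_natCast]
    simp only [Complex.ofReal_one, Complex.ofReal_zero, add_zero]
    rw [bernoulliValue_add_one (k + 2), show k + 2 - 1 = k + 1 from rfl]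
    push_cast
    field_simp
    ring

/-- The derivative in `w` of `(w - 1) ζ(w, z)`. -/
noncomputable def regZetaDeriv (w z : ℂ) : ℂ := deriv (fun w => regZeta w z) w

theorem hasDerivAt_regZeta_left (w : ℂ) {z : ℂ} (hz : z ∈ Complex.slitPlane) :
    HasDerivAt (fun w => regZeta w z) (regZetaDeriv w z) w :=
  (differentiable_regZeta hz w).hasDerivAt

theorem hasDerivAt_regZetaDeriv (w : ℂ) {z : ℂ} (hz : z ∈ Complex.slitPlane) :
    HasDerivAt (regZetaDeriv w)
      (-regZeta (w + 1) z + (1 - w) * regZetaDeriv (w + 1) z) z := by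
  have hG : ∀ z ∈ Complex.slitPlane, ∀ w, HasDerivAt (fun w => (1 - w) * regZeta (w + 1) z)
      (-regZeta (w + 1) z + (1 - w) * regZetaDeriv (w + 1) z) w := by
    intro z hz w
    have h1 : HasDerivAt (fun w : ℂ => 1 - w) (-1) w := by
      simpa using (hasDerivAt_id w).const_sub 1
    refine (h1.mul ((hasDerivAt_regZeta_left (w + 1) hz).comp_add_const w 1)).congr_deriv ?_
    ring
  have := hasDerivAt_deriv_swap (F := regZeta) (G := fun w z => (1 - w) * regZeta (w + 1) z)
    isOpen_univ Complex.isOpen_slitPlane continuousOn_regZeta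
    (ContinuousOn.mul (by fun_prop) (continuousOn_regZeta.comp
      (f := fun p : ℂ × ℂ => (p.1 + 1, p.2)) (by fun_prop) fun p hp => ⟨mem_univ _, hp.2⟩))
    (fun z hz => (differentiable_regZeta hz).differentiableOn)
    (fun z hz w _ => (hG z hz w).differentiableAt.differentiableWithinAt)
    (fun w _ z hz => hasDerivAt_regZeta w hz) (mem_univ w) hz
  rwa [(hG z hz w).deriv] at this

theorem logMilnorGamma_eq {k : ℕ} (hk : k ≠ 0) {z : ℂ} (hz : z ∈ Complex.slitPlane) :
    logMilnorGamma k z = -regZetaDeriv (1 - k) z / k - regZeta (1 - k) z / k ^ 2 := by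
  have hk0 : (k : ℂ) ≠ 0 := by exact_mod_cast hk
  have hne : (1 : ℂ) - k ≠ 1 := by simpa using hk
  have h1 : hurwitzZeta z =ᶠ[𝓝 (1 - (k : ℂ))] fun w => regZeta w z / (w - 1) := by
    filter_upwards [isOpen_compl_singleton.mem_nhds hne] with w hw using hurwitzZeta_eq hz hw
  have h2 : HasDerivAt (fun w : ℂ => w - 1) 1 (1 - (k : ℂ)) := (hasDerivAt_id _).sub_const 1
  have h3 := (hasDerivAt_regZeta_left (1 - (k : ℂ)) hz).fun_div h2 (sub_ne_zero.2 hne)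
  rw [logMilnorGamma, h1.deriv_eq, h3.deriv]
  have : (1 : ℂ) - k - 1 = -k := by ring
  rw [this]
  field_simp

/-- The two undifferentiated R terms cancel. Stated through R, the formula also covers k = 0, where
ζ itself has its pole. -/
theorem hasDerivAt_logMilnorGamma_succ (k : ℕ) {z : ℂ} (hz : z ∈ Complex.slitPlane) :
    HasDerivAt (logMilnorGamma (k + 1)) (-regZetaDeriv (1 - k) z) z := by
  have hk1 : (k : ℂ) + 1 ≠ 0 := by exact_mod_cast k.succ_ne_zero
  have h1 : logMilnorGamma (k + 1) =ᶠ[𝓝 z] fun z =>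
      -regZetaDeriv (1 - ((k + 1 : ℕ) : ℂ)) z / ((k + 1 : ℕ) : ℂ)
        - regZeta (1 - ((k + 1 : ℕ) : ℂ)) z / ((k + 1 : ℕ) : ℂ) ^ 2 := by
    filter_upwards [Complex.isOpen_slitPlane.mem_nhds hz] with y hy
      using logMilnorGamma_eq k.succ_ne_zero hy
  refine HasDerivAt.congr_of_eventuallyEq ?_ h1
  have h2 := hasDerivAt_regZetaDeriv (1 - ((k + 1 : ℕ) : ℂ)) hz
  have h3 := hasDerivAt_regZeta (1 - ((k + 1 : ℕ) : ℂ)) hz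
  refine ((h2.neg.div_const _).sub (h3.div_const _)).congr_deriv ?_
  rw [show 1 - ((k + 1 : ℕ) : ℂ) + 1 = 1 - k by push_cast; ring]
  push_cast
  field_simp
  ring

theorem hasDerivAt_logMilnorGamma {k : ℕ} (hk : k ≠ 0) {z : ℂ} (hz : z ∈ Complex.slitPlane) :
    HasDerivAt (logMilnorGamma (k + 1)) (k * logMilnorGamma k z + bernoulliValue k z / k) z := by
  have hk0 : (k : ℂ) ≠ 0 := by exact_mod_cast hk
  refine (hasDerivAt_logMilnorGamma_succ k hz).congr_deriv ?_
  rw [logMilnorGamma_eq hk hz, regZeta_one_sub_natCast k hz]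
  field_simp
  ring

end SpecialValues

/-! ### The derivative of log 𝒢_1 is the digamma function -/

section Digamma

theorem logMilnorGamma_one_add_one {z : ℂ} (hz : z ∈ Complex.slitPlane) :
    logMilnorGamma 1 (z + 1) = logMilnorGamma 1 z + Complex.log z := by
  have hz0 := Complex.slitPlane_ne_zero hz
  have hz1 : z + 1 ∈ Complex.slitPlane := by simpa using add_ofReal_mem_slitPlane hz zero_le_one
  have h1 : HasDerivAt (fun w : ℂ => z ^ (-w)) (-Complex.log z) 0 := by
    simpa using (hasDerivAt_neg (0 : ℂ)).const_cpow (c := z) (Or.inl hz0)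
  have h2 : HasDerivAt (fun w : ℂ => w - 1) 1 0 := (hasDerivAt_id _).sub_const 1
  have h3 := (h2.mul h1).add (hasDerivAt_regZeta_left 0 hz1)
  have h4 : (fun w => regZeta w z) = fun w => (w - 1) * z ^ (-w) + regZeta w (z + 1) :=
    funext fun w => regZeta_eq_add w hz
  have h5 : regZetaDeriv 0 z = 1 + Complex.log z + regZetaDeriv 0 (z + 1) := by
    rw [regZetaDeriv, h4]
    refine h3.deriv.trans ?_
    simp
  have h6 := regZeta_eq_add 0 hz
  rw [logMilnorGamma_eq one_ne_zero hz, logMilnorGamma_eq one_ne_zero hz1]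
  simp only [Nat.cast_one, sub_self, h5, h6]
  simp
  ring

theorem ofReal_mem_slitPlane_of_pos {x : ℝ} (hx : 0 < x) : (x : ℂ) ∈ Complex.slitPlane :=
  Complex.ofReal_mem_slitPlane.2 hx

theorem regZeta_two_ofReal {x : ℝ} (hx : 0 < x) :
    ∃ y : ℝ, 0 ≤ y ∧ regZeta 2 x = y := by
  refine ⟨∑' n : ℕ, (((n : ℝ) + x) ^ 2)⁻¹, tsum_nonneg fun n => by positivity, ?_⟩
  rw [regZeta_eq_zetaSeries (by simp) (ofReal_mem_slitPlane_of_pos hx), zetaSeries,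
    Complex.ofReal_tsum]
  norm_num
  refine tsum_congr fun n => ?_
  rw [Complex.cpow_neg, show (2 : ℂ) = ((2 : ℕ) : ℂ) by norm_num, Complex.cpow_natCast]

theorem hasDerivAt_logMilnorGamma_one {z : ℂ} (hz : z ∈ Complex.slitPlane) :
    HasDerivAt (logMilnorGamma 1) (-regZetaDeriv 1 z) z := by
  simpa using hasDerivAt_logMilnorGamma_succ 0 hz

theorem hasDerivAt_neg_regZetaDeriv_one {z : ℂ} (hz : z ∈ Complex.slitPlane) :
    HasDerivAt (fun z => -regZetaDeriv 1 z) (regZeta 2 z) z := by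
  have := (hasDerivAt_regZetaDeriv 1 hz).neg
  refine this.congr_deriv ?_
  norm_num

theorem hasDerivAt_re_comp_ofReal {f : ℂ → ℂ} {f' : ℂ} {x : ℝ} (h : HasDerivAt f f' x) :
    HasDerivAt (fun x : ℝ => (f x).re) f'.re x := h.real_of_complex

theorem hasDerivAt_im_comp_ofReal {f : ℂ → ℂ} {f' : ℂ} {x : ℝ} (h : HasDerivAt f f' x) :
    HasDerivAt (fun x : ℝ => (f x).im) f'.im x :=
  Complex.imCLM.hasFDerivAt.comp_hasDerivAt x h.comp_ofReal

/-- R(2, x) is real for x > 0, so Im (log 𝒢_1)' is a constant c and Im log 𝒢_1(y) - c y is constant.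
Comparing y = 1 with y = 2, where log 𝒢_1 agrees because log 1 = 0, forces c = 0. -/
theorem regZetaDeriv_one_im {x : ℝ} (hx : 0 < x) : (regZetaDeriv 1 x).im = 0 := by
  have hd : ∀ y : ℝ, 0 < y → HasDerivAt (fun y : ℝ => (-regZetaDeriv 1 y).im) 0 y := by
    intro y hy
    have := hasDerivAt_im_comp_ofReal
      (hasDerivAt_neg_regZetaDeriv_one (ofReal_mem_slitPlane_of_pos hy))
    obtain ⟨t, -, ht⟩ := regZeta_two_ofReal hy
    rwa [ht, Complex.ofReal_im] at this
  have hconst : ∀ y : ℝ, 0 < y → (-regZetaDeriv 1 y).im = (-regZetaDeriv 1 x).im := by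
    intro y hy
    exact isOpen_Ioi.is_const_of_deriv_eq_zero isPreconnected_Ioi
      (fun t ht => (hd t ht).differentiableAt.differentiableWithinAt)
      (fun t ht => (hd t ht).deriv) (mem_Ioi.2 hy) (mem_Ioi.2 hx)
  set c := (-regZetaDeriv 1 x).im with hc
  have hd2 : ∀ y : ℝ, 0 < y →
      HasDerivAt (fun y : ℝ => (logMilnorGamma 1 y).im - c * y) 0 y := by
    intro y hy
    refine ((hasDerivAt_im_comp_ofReal
      (hasDerivAt_logMilnorGamma_one (ofReal_mem_slitPlane_of_pos hy))).fun_sub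
      ((hasDerivAt_id y).const_mul c)).congr_deriv ?_
    rw [hconst y hy, mul_one, sub_self]
  have h12 := isOpen_Ioi.is_const_of_deriv_eq_zero isPreconnected_Ioi
      (fun t ht => (hd2 t ht).differentiableAt.differentiableWithinAt)
      (fun t ht => (hd2 t ht).deriv) (mem_Ioi.2 (one_pos : (0 : ℝ) < 1))
      (mem_Ioi.2 (two_pos : (0 : ℝ) < 2))
  have h := logMilnorGamma_one_add_one (ofReal_mem_slitPlane_of_pos one_pos)
  rw [Complex.ofReal_one, Complex.log_one, add_zero, one_add_one_eq_two] at h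
  simp only [Complex.ofReal_one, Complex.ofReal_ofNat, h] at h12
  have hc0 : c = 0 := by linarith
  simpa [hc0] using hc.symm

/-- Bohr–Mollerup: the functional equation is `logMilnorGamma_one_add_one`, and log-convexity holds
because the second derivative R(2, x) = ∑ (n + x)^{-2} is nonnegative. -/
theorem exp_logMilnorGamma_one_eq_Gamma {x : ℝ} (hx : 0 < x) :
    Real.exp ((logMilnorGamma 1 x).re - (logMilnorGamma 1 1).re) = Real.Gamma x := by
  refine Real.eq_Gamma_of_log_convex
    (f := fun x : ℝ => Real.exp ((logMilnorGamma 1 x).re - (logMilnorGamma 1 1).re))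
    ?_ ?_ (fun _ => Real.exp_pos _) (by simp) (mem_Ioi.2 hx)
  · have h1 : ∀ y : ℝ, 0 < y → HasDerivAt
        (fun x : ℝ => (logMilnorGamma 1 x).re - (logMilnorGamma 1 1).re)
        (-regZetaDeriv 1 y).re y := fun y hy =>
      (hasDerivAt_re_comp_ofReal
        (hasDerivAt_logMilnorGamma_one (ofReal_mem_slitPlane_of_pos hy))).sub_const _
    have h2 : ∀ y : ℝ, 0 < y → HasDerivAt (fun y : ℝ => (-regZetaDeriv 1 y).re)
        (regZeta 2 y).re y := fun y hy =>
      hasDerivAt_re_comp_ofReal (hasDerivAt_neg_regZetaDeriv_one (ofReal_mem_slitPlane_of_pos hy))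
    have hlog : (Real.log ∘ fun x : ℝ =>
        Real.exp ((logMilnorGamma 1 x).re - (logMilnorGamma 1 1).re)) =
        fun x : ℝ => (logMilnorGamma 1 x).re - (logMilnorGamma 1 1).re :=
      funext fun x => Real.log_exp _
    rw [hlog]
    refine convexOn_of_hasDerivWithinAt2_nonneg (convex_Ioi 0)
      (f' := fun y : ℝ => (-regZetaDeriv 1 y).re) (f'' := fun y : ℝ => (regZeta 2 y).re)
      (fun y hy => (h1 y hy).continuousAt.continuousWithinAt) ?_ ?_ ?_
    · rw [interior_Ioi]
      exact fun y hy => (h1 y hy).hasDerivWithinAt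
    · rw [interior_Ioi]
      exact fun y hy => (h2 y hy).hasDerivWithinAt
    · rw [interior_Ioi]
      intro y hy
      obtain ⟨t, ht0, ht⟩ := regZeta_two_ofReal hy
      simpa [ht] using ht0
  · intro y hy
    have h := logMilnorGamma_one_add_one (ofReal_mem_slitPlane_of_pos hy)
    simp only [Complex.ofReal_add, Complex.ofReal_one, h, Complex.add_re, Complex.log_ofReal_re]
    rw [add_sub_right_comm, Real.exp_add, Real.exp_log hy, mul_comm]

theorem digamma_ofReal {x : ℝ} (hx : 0 < x) :
    Complex.digamma x = -regZetaDeriv 1 x := by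
  have h1 : HasDerivAt Real.Gamma (Real.Gamma x * (-regZetaDeriv 1 x).re) x := by
    have h := ((hasDerivAt_re_comp_ofReal (hasDerivAt_logMilnorGamma_one
      (ofReal_mem_slitPlane_of_pos hx))).sub_const (logMilnorGamma 1 1).re).exp
    rw [exp_logMilnorGamma_one_eq_Gamma hx] at h
    refine h.congr_of_eventuallyEq ?_
    filter_upwards [isOpen_Ioi.mem_nhds (mem_Ioi.2 hx)] with y hy
      using (exp_logMilnorGamma_one_eq_Gamma hy).symm
  have hne : ∀ m : ℕ, (x : ℂ) ≠ -m := by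
    intro m h
    have := congrArg Complex.re h
    have hm : (0 : ℝ) ≤ m := m.cast_nonneg
    simp at this
    linarith
  have h2 := (Complex.differentiableAt_Gamma _ hne).hasDerivAt.comp_ofReal
  have h3 := h1.ofReal_comp
  simp_rw [Complex.Gamma_ofReal] at h2
  have h4 := h2.unique h3
  have hG : (Real.Gamma x : ℂ) ≠ 0 := by exact_mod_cast (Real.Gamma_pos_of_pos hx).ne'
  rw [Complex.digamma_def, logDeriv_apply, h4, Complex.Gamma_ofReal, Complex.ofReal_mul,
    mul_div_cancel_left₀ _ hG]
  apply Complex.ext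
  · simp
  · simp [regZetaDeriv_one_im hx]

theorem digamma_eq {z : ℂ} (hz : z ∈ Complex.slitPlane) :
    Complex.digamma z = -regZetaDeriv 1 z := by
  have hne : ∀ z ∈ Complex.slitPlane, ∀ m : ℕ, z ≠ -m := by
    rintro z hz m rfl
    rw [Complex.mem_slitPlane_iff] at hz
    have hm : (0 : ℝ) ≤ m := m.cast_nonneg
    simp at hz
    linarith
  have h1 : DifferentiableOn ℂ Complex.Gamma Complex.slitPlane := fun z hz =>
    (Complex.differentiableAt_Gamma z (hne z hz)).differentiableWithinAt
  have h2 : DifferentiableOn ℂ Complex.digamma Complex.slitPlane :=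
    (h1.deriv Complex.isOpen_slitPlane).div h1 fun z hz => Complex.Gamma_ne_zero (hne z hz)
  have h3 : DifferentiableOn ℂ (fun z => -regZetaDeriv 1 z) Complex.slitPlane := fun z hz =>
    (hasDerivAt_neg_regZetaDeriv_one hz).differentiableAt.differentiableWithinAt
  have hconn : IsPreconnected Complex.slitPlane :=
    (Complex.starConvex_one_slitPlane.isPathConnected
      Complex.one_mem_slitPlane).isConnected.isPreconnected
  refine (h2.analyticOnNhd Complex.isOpen_slitPlane).eqOn_of_preconnected_of_frequently_eq
    (h3.analyticOnNhd Complex.isOpen_slitPlane) hconn Complex.one_mem_slitPlane ?_ hz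
  -- Positive reals accumulate at 1, so agreement on them suffices for the identity theorem.
  have ht : Tendsto (fun x : ℝ => (x : ℂ)) (𝓝[≠] 1) (𝓝[≠] 1) := by
    refine tendsto_nhdsWithin_iff.2 ⟨?_, ?_⟩
    · exact (Complex.continuous_ofReal.tendsto' 1 1 Complex.ofReal_one).mono_left
        nhdsWithin_le_nhds
    · filter_upwards [self_mem_nhdsWithin] with x hx
      simpa using hx
  refine ht.frequently (Eventually.frequently ?_)
  filter_upwards [mem_nhdsWithin_of_mem_nhds (isOpen_Ioi.mem_nhds (mem_Ioi.2
    (one_pos : (0 : ℝ) < 1)))] with x hx using digamma_ofReal hx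

theorem hasDerivAt_logMilnorGamma_one_digamma {z : ℂ} (hz : z ∈ Complex.slitPlane) :
    HasDerivAt (logMilnorGamma 1) (Complex.digamma z) z := by
  rw [digamma_eq hz]
  exact hasDerivAt_logMilnorGamma_one hz

end Digamma

/-! ### Alternating binomial sums and the Bernoulli addition formula -/

section Combinatorics
open Finset

/-- Pascal's rule: an alternating binomial sum of order m + 1 is a difference of two of order m,
which drives the inductions on m below. -/
theorem sum_range_alternating_succ (m : ℕ) (f : ℕ → ℂ) :
    ∑ j ∈ range (m + 2), (-1) ^ j * ((m + 1).choose j : ℂ) * f j =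
      ∑ j ∈ range (m + 1), (-1) ^ j * (m.choose j : ℂ) * f j -
      ∑ j ∈ range (m + 1), (-1) ^ j * (m.choose j : ℂ) * f (j + 1) := by
  rw [sum_range_succ', sum_congr rfl fun j _ => show (-1) ^ (j + 1) *
    ((m + 1).choose (j + 1) : ℂ) * f (j + 1) = (-1) ^ (j + 1) * (m.choose (j + 1) : ℂ) * f (j + 1)
      - (-1) ^ j * (m.choose j : ℂ) * f (j + 1) by
        rw [Nat.choose_succ_succ]; push_cast; ring, sum_sub_distrib, sub_add_eq_add_sub]
  congr 1
  rw [sum_range_succ, sum_range_succ' (fun j => (-1) ^ j * (m.choose j : ℂ) * f j)]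
  simp

/-- This is an m-th finite difference, up to sign, and each difference lowers the lower index of
C(a, b) by one. -/
theorem sum_alternating_choose_mul_choose (m a b : ℕ) :
    ∑ j ∈ range (m + 1), (-1) ^ j * (m.choose j : ℂ) * ((a + j).choose b : ℂ) =
      (-1) ^ m * if m ≤ b then (a.choose (b - m) : ℂ) else 0 := by
  induction m generalizing a with
  | zero => simp
  | succ m ih =>
    have h := sum_range_alternating_succ m fun j => ((a + j).choose b : ℂ)
    simp only [← add_assoc, add_right_comm a _ 1] at h
    rw [h, ih a, ih (a + 1)]
    rcases lt_trichotomy m b with hb | rfl | hb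
    · obtain ⟨c, rfl⟩ := Nat.exists_eq_add_of_lt hb
      rw [if_pos hb.le, if_pos hb.le, if_pos (by omega),
        show m + c + 1 - m = c + 1 by omega, show m + c + 1 - (m + 1) = c by omega,
        Nat.choose_succ_succ]
      push_cast
      ring
    · simp
    · rw [if_neg (by omega), if_neg (by omega), if_neg (by omega)]
      simp

/-- Both sides are the Beta integral ∫_0^1 x^s (1 - x)^m dx; the induction is its recurrence in m.
-/
theorem sum_alternating_choose_div (m s : ℕ) :
    ∑ j ∈ range (m + 1), (-1) ^ j * (m.choose j : ℂ) * (1 / ((s + 1 + j : ℕ) : ℂ)) =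
      (s.factorial : ℂ) / ((m + 1).ascFactorial (s + 1) : ℂ) := by
  induction m generalizing s with
  | zero =>
    have : (s.factorial : ℂ) ≠ 0 := by exact_mod_cast s.factorial_ne_zero
    have h2 : (s : ℂ) + 1 ≠ 0 := by exact_mod_cast s.succ_ne_zero
    simp [Nat.one_ascFactorial, Nat.factorial_succ]
    field_simp
  | succ m ih =>
    have h := sum_range_alternating_succ m fun j => 1 / ((s + 1 + j : ℕ) : ℂ)
    rw [h, ih s, sum_congr rfl fun j _ => by rw [← add_assoc, add_right_comm (s + 1)], ih (s + 1)]
    have h0 : ((m + 1).ascFactorial (s + 1) : ℂ) ≠ 0 := by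
      exact_mod_cast (Nat.ascFactorial_pos _ _).ne'
    have h0' : ((m + 1 + 1).ascFactorial (s + 1) : ℂ) ≠ 0 := by
      exact_mod_cast (Nat.ascFactorial_pos _ _).ne'
    have h1 : (((m + 1).ascFactorial (s + 1 + 1) : ℕ) : ℂ) =
        (m + 1 + (s + 1)) * ((m + 1).ascFactorial (s + 1) : ℂ) := by
      rw [Nat.ascFactorial_succ]; push_cast; ring
    have h2 : ((m : ℂ) + 1) * ((m + 1 + 1).ascFactorial (s + 1) : ℂ) =
        (m + 1 + (s + 1)) * ((m + 1).ascFactorial (s + 1) : ℂ) := by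
      exact_mod_cast Nat.succ_ascFactorial (m + 1) (s + 1)
    have h3 : (m : ℂ) + 1 + (s + 1) ≠ 0 := by exact_mod_cast (m + 1 + s).succ_ne_zero
    have h4 : ((s + 1).factorial : ℂ) = (s + 1) * s.factorial := by
      exact_mod_cast Nat.factorial_succ s
    rw [h1, h4, div_sub_div _ _ h0 (mul_ne_zero h3 h0), div_eq_div_iff
      (mul_ne_zero h0 (mul_ne_zero h3 h0)) h0']
    linear_combination (s.factorial : ℂ) * ((m + 1).ascFactorial (s + 1) : ℂ) * h2

/-- For n < m the full m-th difference of the polynomial C(x - 1, n) vanishes; the missing term at x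
= 0 is C(-1, n) = (-1)^n. For n ≥ m every summand is zero. -/
theorem sum_alternating_choose_succ_mul_choose (m n : ℕ) :
    ∑ j ∈ range m, (-1) ^ (j + 1) * (m.choose (j + 1) : ℂ) * (j.choose n : ℂ) =
      if n < m then (-1) ^ (n + 1) else 0 := by
  induction m with
  | zero => simp
  | succ m ih =>
    have h : ∀ j ∈ range (m + 1), (-1) ^ (j + 1) * ((m + 1).choose (j + 1) : ℂ) * (j.choose n : ℂ)
        = (-1) ^ (j + 1) * (m.choose (j + 1) : ℂ) * (j.choose n : ℂ)
          - (-1) ^ j * (m.choose j : ℂ) * ((0 + j).choose n : ℂ) := by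
      intro j _
      rw [Nat.choose_succ_succ, zero_add]; push_cast; ring
    rw [sum_congr rfl h, sum_sub_distrib, sum_alternating_choose_mul_choose, sum_range_succ, ih]
    rcases lt_trichotomy m n with hb | rfl | hb
    · rw [if_neg (by omega : ¬ n < m), if_neg (by omega : ¬ n < m + 1), if_pos hb.le,
        Nat.choose_eq_zero_of_lt (by omega : 0 < n - m)]
      simp
    · simp [pow_succ]
    · rw [if_pos hb, if_pos (by omega : n < m + 1), if_neg (by omega : ¬ m ≤ n)]
      simp

theorem sum_alternating_choose_succ_div (m : ℕ) :
    ∑ j ∈ range m, (-1) ^ (j + 1) * (m.choose (j + 1) : ℂ) * (1 / ((j + 1 : ℕ) : ℂ)) =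
      -(harmonic m : ℂ) := by
  induction m with
  | zero => simp
  | succ m ih =>
    have h : ∀ j ∈ range (m + 1), (-1) ^ (j + 1) * ((m + 1).choose (j + 1) : ℂ) *
        (1 / ((j + 1 : ℕ) : ℂ)) = (-1) ^ (j + 1) * (m.choose (j + 1) : ℂ) * (1 / ((j + 1 : ℕ) : ℂ))
          - (-1) ^ j * (m.choose j : ℂ) * (1 / ((0 + 1 + j : ℕ) : ℂ)) := by
      intro j _
      rw [Nat.choose_succ_succ, zero_add, add_comm 1 j]; push_cast; ring
    rw [sum_congr rfl h, sum_sub_distrib, sum_alternating_choose_div, sum_range_succ, ih,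
      harmonic_succ]
    simp [Nat.ascFactorial_succ]
    ring

/-- Summation by parts for the coefficients `(-1)^j C(m, j) t^(m - j)`. -/
theorem sum_alternating_choose_mul_deriv_pow (m : ℕ) (t : ℂ) (G : ℕ → ℂ) :
    ∑ j ∈ range (m + 1), (-1) ^ j * (m.choose j : ℂ) * (((m - j : ℕ) : ℂ) * t ^ (m - j - 1)) *
        G (j + 1) =
      -∑ j ∈ range (m + 1), (-1) ^ j * (m.choose j : ℂ) * t ^ (m - j) * (j * G j) := by
  rw [sum_range_succ, sum_range_succ' (fun j => (-1) ^ j * (m.choose j : ℂ) * t ^ (m - j) *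
    (j * G j)), neg_add, ← sum_neg_distrib]
  congr 1
  · refine sum_congr rfl fun j _ => ?_
    have h : ((m.choose (j + 1) : ℕ) : ℂ) * ((j + 1 : ℕ) : ℂ) =
        (m.choose j : ℂ) * ((m - j : ℕ) : ℂ) := by
      exact_mod_cast Nat.choose_succ_right_eq m j
    rw [show m - (j + 1) = m - j - 1 by omega]
    linear_combination (-1) ^ j * t ^ (m - j - 1) * G (j + 1) * -h
  · simp

/-- By B_n' = n B_{n-1} and induction, the difference of the two sides has zero t-derivative, and it
vanishes at t = 0. -/
theorem bernoulliValue_add (n : ℕ) (t z : ℂ) :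
    bernoulliValue n (t + z) =
      ∑ i ∈ range (n + 1), (n.choose i : ℂ) * bernoulliValue i z * t ^ (n - i) := by
  induction n generalizing t with
  | zero => simp [bernoulliValue_zero]
  | succ n ih =>
    have hd : ∀ t : ℂ, HasDerivAt (fun t => bernoulliValue (n + 1) (t + z) -
        ∑ i ∈ range (n + 1 + 1), ((n + 1).choose i : ℂ) * bernoulliValue i z * t ^ (n + 1 - i))
        0 t := by
      intro t
      have h1 := (hasDerivAt_bernoulliValue (n + 1) (t + z)).comp_add_const t z
      have h2 := HasDerivAt.fun_sum (u := range (n + 1 + 1)) fun i _ =>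
        (hasDerivAt_pow (n + 1 - i) t).const_mul (((n + 1).choose i : ℂ) * bernoulliValue i z)
      refine (h1.fun_sub h2).congr_deriv ?_
      rw [sum_range_succ, Nat.add_sub_cancel, ih, mul_sum, ← sub_sub, ← sum_sub_distrib,
        sum_eq_zero]
      · simp
      · intro i hi
        have hi' : i ≤ n := by simpa [Nat.lt_succ_iff] using hi
        have hc : (((n + 1).choose i : ℕ) : ℂ) * ((n + 1 - i : ℕ) : ℂ) =
            ((n + 1 : ℕ) : ℂ) * (n.choose i : ℂ) := by
          exact_mod_cast (by
            have := Nat.add_one_mul_choose_eq n (n - i)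
            have h3 : n.choose (n - i) = n.choose i := Nat.choose_symm hi'
            have h4 : (n + 1).choose (n - i + 1) = (n + 1).choose i := by
              rw [show n - i + 1 = n + 1 - i by omega]
              exact Nat.choose_symm (by omega)
            rw [h3, h4, show n - i + 1 = n + 1 - i by omega] at this
            exact this.symm)
        rw [show n + 1 - i - 1 = n - i by omega]
        linear_combination -(bernoulliValue i z * t ^ (n - i)) * hc
    have h0 := is_const_of_deriv_eq_zero (fun t => (hd t).differentiableAt)
      (fun t => (hd t).deriv) t 0
    have h1 : ∑ i ∈ range (n + 1), ((n + 1).choose i : ℂ) * bernoulliValue i z *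
        0 ^ (n + 1 - i) = 0 := by
      refine sum_eq_zero fun i hi => ?_
      rw [zero_pow (by have := mem_range.1 hi; omega), mul_zero]
    rw [sum_range_succ (fun i => ((n + 1).choose i : ℂ) * bernoulliValue i z *
      0 ^ (n + 1 - i)), h1] at h0
    rw [← sub_eq_zero, h0]
    simp

end Combinatorics

/-! ### The Bernoulli sum as a polynomial in t -/

section BernoulliSums
open Finset

/-- The Bernoulli contribution to the derivative of the Milnor gamma part. -/
noncomputable def bernoulliSum (m q : ℕ) (t z : ℂ) : ℂ :=
  ∑ j ∈ range (m + 1), (-1) ^ j * (m.choose j : ℂ) * t ^ (m - j) *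
    (bernoulliValue (q + j) (t + z) / ((q + j : ℕ) : ℂ))

theorem bernoulliSum_eq (m q : ℕ) (t z : ℂ) :
    bernoulliSum m q t z = ∑ i ∈ range (m + q + 1), bernoulliValue i z * t ^ (m + q - i) *
      ∑ j ∈ range (m + 1), (-1) ^ j * (m.choose j : ℂ) *
        (((q + j).choose i : ℂ) / ((q + j : ℕ) : ℂ)) := by
  simp only [mul_sum]
  rw [sum_comm, bernoulliSum]
  refine sum_congr rfl fun j hj => ?_
  have hj' : j ≤ m := by simpa [Nat.lt_succ_iff] using hj
  -- All j can share one range for i, since C(q + j, i) = 0 for i > q + j.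
  have hsub : range (q + j + 1) ⊆ range (m + q + 1) := range_subset_range.2 (by omega)
  rw [bernoulliValue_add, sum_div, mul_sum]
  refine (sum_subset hsub fun i _ hi => ?_).trans ?_
  · rw [Nat.choose_eq_zero_of_lt (by simpa using hi : q + j < i)]
    simp
  · refine sum_congr rfl fun i _ => ?_
    rcases le_or_gt i (q + j) with h | h
    · rw [show m + q - i = (m - j) + (q + j - i) by omega, pow_add]
      ring
    · rw [Nat.choose_eq_zero_of_lt h]
      simp

theorem choose_succ_div (a n : ℕ) :
    ((a + 1).choose (n + 1) : ℂ) / ((a + 1 : ℕ) : ℂ) = (a.choose n : ℂ) / ((n + 1 : ℕ) : ℂ) := by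
  have h1 : ((a + 1 : ℕ) : ℂ) ≠ 0 := by exact_mod_cast a.succ_ne_zero
  have h2 : ((n + 1 : ℕ) : ℂ) ≠ 0 := by exact_mod_cast n.succ_ne_zero
  rw [div_eq_div_iff h1 h2]
  have := Nat.add_one_mul_choose_eq a n
  rw [mul_comm] at this
  exact_mod_cast this.symm

/-- The index i = 0 gives the Beta sum and the top power of t. For i ≥ 1 absorption removes the
denominator s + 1 + j, leaving a finite difference. -/
theorem bernoulliSum_succ (m s : ℕ) (t z : ℂ) :
    bernoulliSum m (s + 1) t z =
      (s.factorial : ℂ) / ((m + 1).ascFactorial (s + 1) : ℂ) * t ^ (m + s + 1) +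
      ∑ l ∈ range (m + s + 1), (-1) ^ m * (s.choose l : ℂ) *
        (bernoulliValue (m + s + 1 - l) z / ((m + s + 1 - l : ℕ) : ℂ)) * t ^ l := by
  rw [bernoulliSum_eq, ← add_assoc, sum_range_succ' _ (m + s + 1), add_comm]
  congr 1
  · simp [bernoulliValue_zero, ← sum_alternating_choose_div, mul_comm]
  · rw [← sum_range_reflect]
    refine sum_congr rfl fun l hl => ?_
    have hl' : l ≤ m + s := by simpa [Nat.lt_succ_iff] using hl
    rw [show m + s + 1 - 1 - l = m + s - l by omega, show m + s + 1 - (m + s - l + 1) = l by omega,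
      show m + s + 1 - l = m + s - l + 1 by omega]
    have h : ∀ j ∈ range (m + 1), (-1) ^ j * (m.choose j : ℂ) *
        (((s + 1 + j).choose (m + s - l + 1) : ℂ) / ((s + 1 + j : ℕ) : ℂ)) =
        (-1) ^ j * (m.choose j : ℂ) * ((s + j).choose (m + s - l) : ℂ) /
          ((m + s - l + 1 : ℕ) : ℂ) := by
      intro j _
      rw [add_right_comm s 1 j, choose_succ_div, mul_div_assoc]
    rw [sum_congr rfl h, ← sum_div, sum_alternating_choose_mul_choose]
    have hc : (if m ≤ m + s - l then (s.choose (m + s - l - m) : ℂ) else 0) = s.choose l := by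
      split_ifs with hm
      · rw [show m + s - l - m = s - l by omega, Nat.choose_symm (by omega)]
      · rw [Nat.choose_eq_zero_of_lt (by omega), Nat.cast_zero]
    rw [hc]
    ring

/-- At q = 0 the j = 0 summand is a division by zero, hence 0. The sums therefore start at j = 1,
which is where the harmonic number and the signs (-1)^{m+l} come from. -/
theorem bernoulliSum_zero (m : ℕ) (t z : ℂ) :
    bernoulliSum m 0 t z = -(harmonic m : ℂ) * t ^ m +
      ∑ l ∈ range m, (-1) ^ (m + l) *
        (bernoulliValue (m - l) z / ((m - l : ℕ) : ℂ)) * t ^ l := by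
  rw [bernoulliSum_eq, add_zero, sum_range_succ' _ m, add_comm]
  congr 1
  · rw [sum_range_succ' _ m, ← sum_alternating_choose_succ_div]
    simp [bernoulliValue_zero, mul_comm]
  · rw [← sum_range_reflect]
    refine sum_congr rfl fun l hl => ?_
    have hl' : l < m := by simpa using hl
    obtain ⟨n, rfl⟩ := Nat.exists_eq_add_of_lt hl'
    rw [show l + n + 1 - 1 - l = n by omega, show l + n + 1 - (n + 1) = l by omega,
      show l + n + 1 - l = n + 1 by omega, sum_range_succ']
    have h : ∀ j ∈ range (l + n + 1), (-1) ^ (j + 1) * ((l + n + 1).choose (j + 1) : ℂ) *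
        (((0 + (j + 1)).choose (n + 1) : ℂ) / ((0 + (j + 1) : ℕ) : ℂ)) =
        (-1) ^ (j + 1) * ((l + n + 1).choose (j + 1) : ℂ) * (j.choose n : ℂ) /
          ((n + 1 : ℕ) : ℂ) := by
      intro j _
      rw [zero_add, choose_succ_div, mul_div_assoc]
    rw [sum_congr rfl h, ← sum_div, sum_alternating_choose_succ_mul_choose, if_pos (by omega)]
    have hs : (-1 : ℂ) ^ (l + n + 1 + l) = (-1) ^ (n + 1) := by
      rw [show l + n + 1 + l = 2 * l + (n + 1) by ring, pow_add, pow_mul]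
      simp
    rw [hs]
    simp
    ring

end BernoulliSums

/-! ### Recurrences for the coefficients of P -/

section Remainder
open Finset

/-- The coefficient of `B_{m+s+1-l}(z) / (m+s+1-l) t^l` in `P^m_{s+1}(t, z)`. -/
noncomputable def remainderCoeff (m s l : ℕ) : ℂ :=
  if l ≤ s then (-1) ^ (m + 1) / (s.factorial : ℂ) * (s.choose l : ℂ) *
    (harmonicDiff (s + 1 - l) s : ℂ)
  else (-1) ^ (m + s) / ((s + 1).factorial : ℂ) * (-1) ^ l / (l.choose (s + 1) : ℂ)

theorem harmonicDiff_succ_self (s : ℕ) : harmonicDiff (s + 1) s = 0 := by simp [harmonicDiff]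

theorem remainderPoly_eval (m s : ℕ) (t z : ℂ) :
    (remainderPoly m (s + 1) z).eval t =
      (harmonicDiff (s + 1) m : ℂ) / ((m + 1).ascFactorial (s + 1) : ℂ) * t ^ (m + s + 1) +
      ∑ l ∈ range (m + s + 1), remainderCoeff m s l *
        (bernoulliValue (m + s + 1 - l) z / ((m + s + 1 - l : ℕ) : ℂ)) * t ^ l +
      (-1) ^ (m + 1) / (s.factorial : ℂ) *
        ∑ k ∈ range (s + 1), (s.choose k : ℂ) * logMilnorGamma (m + s + 1 - k) z * t ^ k := by
  simp only [remainderPoly, eval_add, eval_mul, eval_C, eval_pow, eval_X, eval_finsetSum,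
    ← add_assoc, Nat.add_sub_cancel]
  congr 1
  rw [add_assoc]
  congr 1
  rw [range_eq_Ico, ← sum_Ico_consecutive _ (Nat.zero_le (s + 1)) (by omega : s + 1 ≤ m + s + 1),
    add_comm]
  congr 1
  -- P has no Bernoulli term at l = 0; including it is harmless because H(s + 1, s) = 0.
  · rw [sum_eq_sum_Ico_succ_bot (by omega), remainderCoeff, if_pos (by omega), Nat.sub_zero,
      harmonicDiff_succ_self, mul_sum]
    simp only [Rat.cast_zero, mul_zero, zero_mul, zero_add]
    refine sum_congr (by ext; simp) fun l hl => ?_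
    have hl' : l ≤ s := by simp at hl; omega
    rw [remainderCoeff, if_pos hl']
    ring
  · rw [mul_sum]
    refine sum_congr (by ext; simp) fun l hl => ?_
    have hl' : ¬ l ≤ s := by simp at hl; omega
    rw [remainderCoeff, if_neg hl']
    ring

theorem harmonicDiff_succ (a b : ℕ) :
    (harmonicDiff a (b + 1) : ℂ) = harmonicDiff a b + 1 / ((b : ℂ) + 1) := by
  simp [harmonicDiff, harmonic_succ]
  ring

/-- Matches the coefficients of t^l in the derivative of order s + 2 with those of order s + 1. For
l ≤ s the Bernoulli sum cancels the new summand 1/(s + 1) of H; for l > s it contributes nothing. -/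
theorem remainderCoeff_succ (m s l : ℕ) :
    ((l : ℂ) + 1) * remainderCoeff m (s + 1) (l + 1) +
      (-1) ^ m * (s.choose l : ℂ) / ((s + 1).factorial : ℂ) = remainderCoeff m s l := by
  have hs : (s.factorial : ℂ) ≠ 0 := by exact_mod_cast s.factorial_ne_zero
  have hs1 : (s : ℂ) + 1 ≠ 0 := by exact_mod_cast s.succ_ne_zero
  have hs2 : (s : ℂ) + 2 ≠ 0 := by exact_mod_cast (s + 1).succ_ne_zero
  have hf : ((s + 1).factorial : ℂ) = (s + 1) * s.factorial := by
    exact_mod_cast Nat.factorial_succ s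
  have hf2 : ((s + 1 + 1).factorial : ℂ) = (s + 2) * ((s + 1) * s.factorial) := by
    rw [Nat.factorial_succ, Nat.cast_mul, hf]; push_cast; ring
  rcases le_or_gt l s with h | h
  · rw [remainderCoeff, remainderCoeff, if_pos (by omega), if_pos h,
      show s + 1 + 1 - (l + 1) = s + 1 - l by omega, harmonicDiff_succ, hf]
    have hc : ((s + 1).choose (l + 1) : ℂ) * (l + 1) = (s + 1) * (s.choose l : ℂ) := by
      exact_mod_cast (Nat.add_one_mul_choose_eq s l).symm
    have hc' : ((s + 1).choose (l + 1) : ℂ) = (s + 1) * (s.choose l : ℂ) / (l + 1) := by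
      rw [eq_div_iff (by exact_mod_cast l.succ_ne_zero), hc]
    have hl : (l : ℂ) + 1 ≠ 0 := by exact_mod_cast l.succ_ne_zero
    rw [hc']
    field_simp
    ring
  · rw [remainderCoeff, remainderCoeff, if_neg (by omega), if_neg (by omega),
      Nat.choose_eq_zero_of_lt h, hf, hf2]
    have hc : ((l + 1).choose (s + 1 + 1) : ℂ) * (s + 2) = (l + 1) * (l.choose (s + 1) : ℂ) := by
      have := (Nat.add_one_mul_choose_eq l (s + 1)).symm
      exact_mod_cast this
    have hl0 : (l.choose (s + 1) : ℂ) ≠ 0 := by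
      exact_mod_cast (Nat.choose_pos (by omega : s + 1 ≤ l)).ne'
    have hc' : ((l + 1).choose (s + 1 + 1) : ℂ) = (l + 1) * (l.choose (s + 1) : ℂ) / (s + 2) := by
      rw [eq_div_iff hs2, hc]
    have hl : (l : ℂ) + 1 ≠ 0 := by exact_mod_cast l.succ_ne_zero
    rw [hc']
    field_simp
    ring

theorem remainderCoeff_zero (m l : ℕ) :
    ((l : ℂ) + 1) * remainderCoeff m 0 (l + 1) + (-1) ^ (m + l) = 0 := by
  have hl : (l : ℂ) + 1 ≠ 0 := by exact_mod_cast l.succ_ne_zero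
  rw [remainderCoeff, if_neg (by omega)]
  simp
  field_simp
  ring

/-- The same matching for the top power of t. As H(a, b) is a difference of harmonic numbers, no
comparison of s with m is needed. -/
theorem leadingCoeff_succ (m s : ℕ) :
    (harmonicDiff (s + 2) m : ℂ) / ((m + 1).ascFactorial (s + 2) : ℂ) * ((m : ℂ) + s + 2) +
      (s.factorial : ℂ) / ((m + 1).ascFactorial (s + 1) : ℂ) / ((s + 1).factorial : ℂ) =
      (harmonicDiff (s + 1) m : ℂ) / ((m + 1).ascFactorial (s + 1) : ℂ) := by
  have h0 : ((m + 1).ascFactorial (s + 1) : ℂ) ≠ 0 := by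
    exact_mod_cast (Nat.ascFactorial_pos _ _).ne'
  have h1 : (((m + 1).ascFactorial (s + 2) : ℕ) : ℂ) =
      (m + s + 2) * ((m + 1).ascFactorial (s + 1) : ℂ) := by
    rw [Nat.ascFactorial_succ]; push_cast; ring
  have hs : (s.factorial : ℂ) ≠ 0 := by exact_mod_cast s.factorial_ne_zero
  have hs1 : (s : ℂ) + 1 ≠ 0 := by exact_mod_cast s.succ_ne_zero
  have hf : ((s + 1).factorial : ℂ) = (s + 1) * s.factorial := by
    exact_mod_cast Nat.factorial_succ s
  have hms : (m : ℂ) + s + 2 ≠ 0 := by exact_mod_cast (m + s + 1).succ_ne_zero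
  have hH : (harmonicDiff (s + 1) m : ℂ) = harmonicDiff (s + 2) m + 1 / ((s : ℂ) + 1) := by
    simp [harmonicDiff, harmonic_succ]
    ring
  rw [h1, hf, hH]
  field_simp

end Remainder

/-! ### The closed form as iterated primitive -/

section Primitive

theorem segmentIntegral_eq_sub {F f : ℂ → ℂ} {t : ℂ}
    (hF : ∀ u ∈ Icc (0 : ℝ) 1, HasDerivAt F (f (u * t)) (u * t))
    (hf : ContinuousOn (fun u : ℝ => f (u * t)) (Icc 0 1)) :
    segmentIntegral f t = F t - F 0 := by
  have key := intervalIntegral.integral_eq_sub_of_hasDerivAt (a := 0) (b := 1)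
    (f := fun u : ℝ => F (u * t)) (f' := fun u : ℝ => t * f (u * t))
    (fun u hu => by
      rw [uIcc_of_le zero_le_one] at hu
      have h1 : HasDerivAt (fun u : ℝ => (u : ℂ) * t) t u := by
        simpa using (Complex.ofRealCLM.hasDerivAt (x := u)).mul_const t
      refine ((hF u hu).comp u h1).congr_deriv (mul_comm _ _))
    (ContinuousOn.intervalIntegrable (by
      rw [uIcc_of_le zero_le_one]
      exact continuousOn_const.mul hf))
  rw [intervalIntegral.integral_const_mul] at key
  simpa [segmentIntegral] using key

theorem segmentIntegral_congr {f g : ℂ → ℂ} {t : ℂ}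
    (h : ∀ u ∈ Icc (0 : ℝ) 1, f (u * t) = g (u * t)) :
    segmentIntegral f t = segmentIntegral g t := by
  rw [segmentIntegral, segmentIntegral]
  congr 1
  refine intervalIntegral.integral_congr fun u hu => ?_
  rw [uIcc_of_le zero_le_one] at hu
  exact h u hu

open Finset in
/-- The closed form of the iterated integral, of order `s + 1`. -/
noncomputable def closedForm (m s : ℕ) (z t : ℂ) : ℂ :=
  (∑ j ∈ range (m + 1), (-1) ^ j * (m.choose j : ℂ) * t ^ (m - j) *
    logMilnorGamma (s + 1 + j) (t + z)) / (s.factorial : ℂ) + (remainderPoly m (s + 1) z).eval t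

open Finset in
theorem closedForm_eq (m s : ℕ) (z t : ℂ) : closedForm m s z t =
    (∑ k ∈ Finset.Icc (s + 1) (m + (s + 1)),
      (-1) ^ (k + (s + 1)) / ((s + 1 - 1).factorial : ℂ) * (m.choose (k - (s + 1)) : ℂ)
        * t ^ (m + (s + 1) - k) * logMilnorGamma k (t + z)) +
      (remainderPoly m (s + 1) z).eval t := by
  rw [closedForm, show Finset.Icc (s + 1) (m + (s + 1)) = Finset.Ico (s + 1) (m + 1 + (s + 1)) by
    ext; simp; omega, sum_Ico_eq_sum_range, sum_div, Nat.add_sub_cancel]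
  congr 1
  refine sum_congr rfl fun j _ => ?_
  have hp : (-1 : ℂ) ^ (s + 1 + j + (s + 1)) = (-1) ^ j := by
    rw [show s + 1 + j + (s + 1) = 2 * (s + 1) + j by ring, pow_add, pow_mul]
    simp
  rw [hp, Nat.add_sub_cancel, Nat.add_sub_cancel_left,
    show m + (s + 1) - (s + 1 + j) = m - j by omega]
  ring

/-- At t = 0 only j = m survives in the gamma part, and it cancels the k = 0 term of the last sum of
P. -/
theorem closedForm_zero (m s : ℕ) (z : ℂ) : closedForm m s z 0 = 0 := by
  have h1 : ∀ j ∈ Finset.range m, (-1) ^ j * (m.choose j : ℂ) * (0 : ℂ) ^ (m - j) *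
      logMilnorGamma (s + 1 + j) (0 + z) = 0 := by
    intro j hj
    rw [zero_pow (by have := Finset.mem_range.1 hj; omega)]
    simp
  have hf : (s.factorial : ℂ) ≠ 0 := by exact_mod_cast s.factorial_ne_zero
  rw [closedForm, remainderPoly_eval, Finset.sum_range_succ, Finset.sum_eq_zero h1,
    Finset.sum_range_succ', Finset.sum_eq_zero (by simp), Finset.sum_range_succ' _ s,
    Finset.sum_eq_zero (by simp), remainderCoeff, if_pos s.zero_le, Nat.sub_zero,
    harmonicDiff_succ_self]
  simp [show s + 1 + m = m + s + 1 by ring]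
  field_simp
  ring

-- The parameter c treats both cases at once: c = ψ(t + z) for q = 0, where the other two terms of
-- `hc` are zero, and c = 0 for q ≥ 1.
open Finset in
theorem hasDerivAt_milnorPart (m q : ℕ) {t z : ℂ} (c : ℂ) (ht : t + z ∈ Complex.slitPlane)
    (hc : HasDerivAt (fun t => logMilnorGamma (q + 1) (t + z))
      (c + q * logMilnorGamma q (t + z) + bernoulliValue q (t + z) / q) t) :
    HasDerivAt (fun t => ∑ j ∈ range (m + 1), (-1) ^ j * (m.choose j : ℂ) * t ^ (m - j) *
        logMilnorGamma (q + 1 + j) (t + z))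
      (c * t ^ m + q * ∑ j ∈ range (m + 1), (-1) ^ j * (m.choose j : ℂ) * t ^ (m - j) *
        logMilnorGamma (q + j) (t + z) + bernoulliSum m q t z) t := by
  have hg : ∀ j : ℕ, HasDerivAt (fun t => logMilnorGamma (q + 1 + j) (t + z))
      ((if j = 0 then c else 0) + ((q + j : ℕ) : ℂ) * logMilnorGamma (q + j) (t + z) +
        bernoulliValue (q + j) (t + z) / ((q + j : ℕ) : ℂ)) t := by
    intro j
    rcases Nat.eq_zero_or_pos j with rfl | hj
    · simpa using hc
    · rw [if_neg hj.ne', zero_add, add_right_comm]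
      exact (hasDerivAt_logMilnorGamma (by omega) ht).comp_add_const t z
  have hd := HasDerivAt.fun_sum (u := range (m + 1)) fun j _ =>
    ((hasDerivAt_pow (m - j) t).const_mul ((-1) ^ j * (m.choose j : ℂ))).mul (hg j)
  refine hd.congr_deriv ?_
  -- The derivatives of the powers of t cancel the part j of the factor q + j in front of log
  -- 𝒢_{q+j}, leaving q.
  have hS := sum_alternating_choose_mul_deriv_pow m t fun j => logMilnorGamma (q + j) (t + z)
  have hI : ∑ j ∈ range (m + 1), (-1) ^ j * (m.choose j : ℂ) * t ^ (m - j) *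
      (if j = 0 then c else 0) = c * t ^ m := by
    rw [sum_range_succ', sum_eq_zero (by simp)]
    simp [mul_comm]
  rw [← hI, bernoulliSum, mul_sum, sum_add_distrib, ← eq_sub_iff_add_eq]
  simp only [← add_assoc, add_right_comm q _ 1] at hS ⊢
  rw [hS, ← sum_neg_distrib, ← sum_add_distrib, ← sum_add_distrib, ← sum_sub_distrib]
  refine sum_congr rfl fun j _ => ?_
  push_cast
  ring

open Finset in
theorem hasDerivAt_remainderPoly (m s : ℕ) (t z : ℂ) :
    HasDerivAt (fun t => (remainderPoly m (s + 1) z).eval t)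
      ((harmonicDiff (s + 1) m : ℂ) / ((m + 1).ascFactorial (s + 1) : ℂ) *
          (((m : ℂ) + s + 1) * t ^ (m + s)) +
      ∑ l ∈ range (m + s), ((l : ℂ) + 1) * remainderCoeff m s (l + 1) *
        (bernoulliValue (m + s - l) z / ((m + s - l : ℕ) : ℂ)) * t ^ l +
      (-1) ^ (m + 1) / (s.factorial : ℂ) *
        ∑ k ∈ range s, (s.choose (k + 1) : ℂ) * ((k : ℂ) + 1) *
          logMilnorGamma (m + s - k) z * t ^ k) t := by
  have h : (fun t => (remainderPoly m (s + 1) z).eval t) = fun t => _ :=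
    funext fun t => remainderPoly_eval m s t z
  rw [h]
  have h1 := (hasDerivAt_pow (m + s + 1) t).const_mul
    ((harmonicDiff (s + 1) m : ℂ) / ((m + 1).ascFactorial (s + 1) : ℂ))
  have h2 := HasDerivAt.fun_sum (u := range (m + s + 1)) fun l _ =>
    (hasDerivAt_pow l t).const_mul (remainderCoeff m s l *
        (bernoulliValue (m + s + 1 - l) z / ((m + s + 1 - l : ℕ) : ℂ)))
  have h3 := (HasDerivAt.fun_sum (u := range (s + 1)) fun k _ =>
    (hasDerivAt_pow k t).const_mul ((s.choose k : ℂ) * logMilnorGamma (m + s + 1 - k) z)).const_mul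
    ((-1) ^ (m + 1) / (s.factorial : ℂ))
  refine ((h1.add h2).add h3).congr_deriv ?_
  congr 1
  · congr 1
    · push_cast
      simp
    · rw [sum_range_succ']
      simp only [Nat.cast_zero, zero_mul, mul_zero, add_zero, Nat.add_sub_cancel,
        Nat.add_sub_add_right]
      refine sum_congr rfl fun l _ => ?_
      push_cast
      ring
  · rw [sum_range_succ']
    simp only [Nat.cast_zero, zero_mul, mul_zero, add_zero, Nat.add_sub_cancel,
      Nat.add_sub_add_right]
    congr 1
    refine sum_congr rfl fun l _ => ?_
    push_cast
    ring

open Finset in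
theorem hasDerivAt_closedForm_zero (m : ℕ) {t z : ℂ} (ht : t + z ∈ Complex.slitPlane) :
    HasDerivAt (closedForm m 0 z) (t ^ m * Complex.digamma (t + z)) t := by
  have h1 := hasDerivAt_milnorPart m 0 (Complex.digamma (t + z)) ht (by
    simpa using (hasDerivAt_logMilnorGamma_one_digamma ht).comp_add_const t z)
  refine ((h1.div_const _).add (hasDerivAt_remainderPoly m 0 t z)).congr_deriv ?_
  rw [bernoulliSum_zero]
  have hm : (m : ℂ) + 1 ≠ 0 := by exact_mod_cast m.succ_ne_zero
  have hz : ∑ l ∈ range m, (-1) ^ (m + l) *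
        (bernoulliValue (m - l) z / ((m - l : ℕ) : ℂ)) * t ^ l +
      ∑ l ∈ range (m + 0), ((l : ℂ) + 1) * remainderCoeff m 0 (l + 1) *
        (bernoulliValue (m + 0 - l) z / ((m + 0 - l : ℕ) : ℂ)) * t ^ l = 0 := by
    rw [add_zero, ← sum_add_distrib]
    refine sum_eq_zero fun l _ => ?_
    linear_combination (bernoulliValue (m - l) z / ((m - l : ℕ) : ℂ)) * t ^ l *
      remainderCoeff_zero m l
  have hH : (harmonicDiff (0 + 1) m : ℂ) / ((m + 1).ascFactorial (0 + 1) : ℂ) *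
      (((m : ℂ) + (0 : ℕ) + 1) * t ^ (m + 0)) = (harmonic m : ℂ) * t ^ m := by
    simp [harmonicDiff, Nat.ascFactorial_succ]
    field_simp
  rw [hH]
  simp only [Nat.factorial_zero, Nat.cast_one, div_one, Nat.cast_zero, range_zero, sum_empty,
    mul_zero, zero_mul, add_zero] at hz ⊢
  linear_combination hz

open Finset in
theorem hasDerivAt_closedForm_succ (m s : ℕ) {t z : ℂ} (ht : t + z ∈ Complex.slitPlane) :
    HasDerivAt (closedForm m (s + 1) z) (closedForm m s z t) t := by
  have h1 := hasDerivAt_milnorPart m (s + 1) 0 ht (by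
    rw [zero_add]
    exact (hasDerivAt_logMilnorGamma s.succ_ne_zero ht).comp_add_const t z)
  refine ((h1.div_const _).add (hasDerivAt_remainderPoly m (s + 1) t z)).congr_deriv ?_
  rw [bernoulliSum_succ, closedForm, remainderPoly_eval]
  have hs : (s.factorial : ℂ) ≠ 0 := by exact_mod_cast s.factorial_ne_zero
  have hs1 : (s : ℂ) + 1 ≠ 0 := by exact_mod_cast s.succ_ne_zero
  have hf : ((s + 1).factorial : ℂ) = (s + 1) * s.factorial := by
    exact_mod_cast Nat.factorial_succ s
  have hL : (-1) ^ (m + 1) / ((s + 1).factorial : ℂ) *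
        ∑ k ∈ range (s + 1), ((s + 1).choose (k + 1) : ℂ) * ((k : ℂ) + 1) *
          logMilnorGamma (m + (s + 1) - k) z * t ^ k =
      (-1) ^ (m + 1) / (s.factorial : ℂ) *
        ∑ k ∈ range (s + 1), (s.choose k : ℂ) * logMilnorGamma (m + s + 1 - k) z * t ^ k := by
    rw [mul_sum, mul_sum]
    refine sum_congr rfl fun k _ => ?_
    have hc : ((s + 1).choose (k + 1) : ℂ) * (k + 1) = (s + 1) * (s.choose k : ℂ) := by
      exact_mod_cast (Nat.add_one_mul_choose_eq s k).symm
    rw [hc, hf, ← add_assoc]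
    field_simp
  have hB : ∑ l ∈ range (m + (s + 1)), ((l : ℂ) + 1) * remainderCoeff m (s + 1) (l + 1) *
        (bernoulliValue (m + (s + 1) - l) z / ((m + (s + 1) - l : ℕ) : ℂ)) * t ^ l +
      (∑ l ∈ range (m + s + 1), (-1) ^ m * (s.choose l : ℂ) *
        (bernoulliValue (m + s + 1 - l) z / ((m + s + 1 - l : ℕ) : ℂ)) * t ^ l) /
          ((s + 1).factorial : ℂ) =
      ∑ l ∈ range (m + s + 1), remainderCoeff m s l *
        (bernoulliValue (m + s + 1 - l) z / ((m + s + 1 - l : ℕ) : ℂ)) * t ^ l := by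
    rw [sum_div, ← add_assoc, ← sum_add_distrib]
    refine sum_congr rfl fun l _ => ?_
    rw [← remainderCoeff_succ m s l]
    ring
  have hA := leadingCoeff_succ m s
  rw [hL, ← hB, ← hA]
  have hM : ∀ X : ℂ, ((s + 1 : ℕ) : ℂ) * X / ((s + 1).factorial : ℂ) = X / s.factorial := by
    intro X
    rw [hf]
    push_cast
    field_simp
  rw [zero_mul, zero_add, add_div, hM]
  push_cast
  simp only [← add_assoc]
  ring

theorem segment_subset_slitPlane_iff {z t : ℂ} :
    segment ℝ z (t + z) ⊆ Complex.slitPlane ↔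
      ∀ u ∈ Icc (0 : ℝ) 1, u * t + z ∈ Complex.slitPlane := by
  rw [segment_eq_image', image_subset_iff]
  refine forall₂_congr fun u _ => ?_
  simp [add_comm]

theorem iteratedDigamma_eq_closedForm (m s : ℕ) {z t : ℂ}
    (ht : ∀ u ∈ Icc (0 : ℝ) 1, u * t + z ∈ Complex.slitPlane) :
    iteratedDigamma m (s + 1) t z = closedForm m s z t := by
  induction s generalizing t with
  | zero =>
    rw [iteratedDigamma, Function.iterate_succ_apply', Function.iterate_zero_apply,
      segmentIntegral_eq_sub (F := closedForm m 0 z)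
        (fun u hu => hasDerivAt_closedForm_zero m (ht u hu)) ?_, closedForm_zero, sub_zero]
    refine ContinuousOn.mul (by fun_prop) fun u hu => ContinuousAt.continuousWithinAt ?_
    have hd : ContinuousAt Complex.digamma (u * t + z) := by
      refine (hasDerivAt_neg_regZetaDeriv_one (ht u hu)).continuousAt.congr ?_
      filter_upwards [Complex.isOpen_slitPlane.mem_nhds (ht u hu)] with y hy
        using (digamma_eq hy).symm
    exact ContinuousAt.comp (f := fun u : ℝ => (u : ℂ) * t + z) hd (by fun_prop)
  | succ s ih =>
    -- The induction hypothesis is needed at each u t, and the segment from z to u t + z is part of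
    -- the given one.
    have hmul : ∀ u ∈ Icc (0 : ℝ) 1, ∀ v ∈ Icc (0 : ℝ) 1,
        (v : ℂ) * (u * t) + z ∈ Complex.slitPlane := by
      intro u hu v hv
      have := ht (v * u) ⟨mul_nonneg hv.1 hu.1, mul_le_one₀ hv.2 hu.1 hu.2⟩
      rwa [Complex.ofReal_mul, mul_assoc] at this
    have hcont : ∀ u ∈ Icc (0 : ℝ) 1, ContinuousAt (closedForm m s z) (u * t) := by
      intro u hu
      cases s with
      | zero => exact (hasDerivAt_closedForm_zero m (ht u hu)).continuousAt
      | succ s => exact (hasDerivAt_closedForm_succ m s (ht u hu)).continuousAt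
    rw [iteratedDigamma, Function.iterate_succ_apply', segmentIntegral_congr (g := closedForm m s z)
      fun u hu => ih (hmul u hu), segmentIntegral_eq_sub (F := closedForm m (s + 1) z)
        (fun u hu => hasDerivAt_closedForm_succ m s (ht u hu)) ?_, closedForm_zero, sub_zero]
    exact fun u hu => (ContinuousAt.comp (f := fun u : ℝ => (u : ℂ) * t) (hcont u hu)
      (by fun_prop)).continuousWithinAt

end Primitive

/-! ### The degree of P -/

section Degree

theorem exists_remainderPoly_eq (m r : ℕ) (hr : 1 ≤ r) (z : ℂ) : ∃ Q : ℂ[X],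
    Q.natDegree < m + r ∧ remainderPoly m r z =
      C ((harmonicDiff r m : ℂ) / ((m + 1).ascFactorial r : ℂ)) * X ^ (m + r) + Q := by
  refine ⟨_, ?_, by rw [remainderPoly, add_assoc, add_assoc]⟩
  have hsum : ∀ (a : ℂ) (S : Finset ℕ) (f : ℕ → ℂ), (∀ l ∈ S, l ≤ m + r - 1) →
      (C a * ∑ l ∈ S, C (f l) * X ^ l).natDegree ≤ m + r - 1 := by
    intro a S f hS
    refine (natDegree_C_mul_le _ _).trans (natDegree_sum_le_of_forall_le _ _ fun l hl => ?_)
    exact (natDegree_C_mul_X_pow_le _ _).trans (hS l hl)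
  refine lt_of_le_of_lt (natDegree_add_le_of_degree_le (hsum _ _ _ fun l hl => ?_)
    (natDegree_add_le_of_degree_le (hsum _ _ _ fun l hl => ?_) (hsum _ _ _ fun l hl => ?_)))
    (by omega : m + r - 1 < m + r)
  · exact (Finset.mem_Icc.1 hl).2
  · have := (Finset.mem_Icc.1 hl).2
    omega
  · have := Finset.mem_range.1 hl
    omega

theorem natDegree_remainderPoly_le (m r : ℕ) (hr : 1 ≤ r) (z : ℂ) :
    (remainderPoly m r z).natDegree ≤ m + r := by
  obtain ⟨Q, hQ, h⟩ := exists_remainderPoly_eq m r hr z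
  rw [h]
  exact natDegree_add_le_of_degree_le (natDegree_C_mul_X_pow_le _ _) hQ.le

theorem strictMono_harmonic : StrictMono harmonic :=
  strictMono_nat_of_lt_succ fun n => by
    rw [harmonic_succ]
    have : (0 : ℚ) < ((n + 1 : ℕ) : ℚ)⁻¹ := by positivity
    linarith

/-- The coefficient of t^{m+r} has numerator H(m) - H(r - 1), nonzero since the harmonic numbers
strictly increase. -/
theorem natDegree_remainderPoly (m r : ℕ) (hr : 1 ≤ r) (hmr : m + 1 ≠ r) (z : ℂ) :
    (remainderPoly m r z).natDegree = m + r := by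
  refine natDegree_eq_of_le_of_coeff_ne_zero (natDegree_remainderPoly_le m r hr z) ?_
  obtain ⟨Q, hQ, h⟩ := exists_remainderPoly_eq m r hr z
  rw [h, coeff_add, coeff_eq_zero_of_natDegree_lt hQ, add_zero, coeff_C_mul, coeff_X_pow_self,
    mul_one]
  refine div_ne_zero ?_ ?_
  · rw [Rat.cast_ne_zero, harmonicDiff, sub_ne_zero]
    exact fun h => hmr (by have := strictMono_harmonic.injective h; omega)
  · exact_mod_cast (Nat.ascFactorial_pos _ _).ne'

end Degree
end DepthGamma

theorem theorem4 (m r : ℕ) (hr : 1 ≤ r) (z : ℂ) :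
    (∀ t : ℂ, segment ℝ z (t + z) ⊆ Complex.slitPlane →
      DepthGamma.iteratedDigamma m r t z
        = (∑ k ∈ Finset.Icc r (m + r),
            (-1) ^ (k + r) / ((r - 1).factorial : ℂ) * (m.choose (k - r) : ℂ)
              * t ^ (m + r - k) * DepthGamma.logMilnorGamma k (t + z))
          + (DepthGamma.remainderPoly m r z).eval t) ∧
    (DepthGamma.remainderPoly m r z).natDegree ≤ m + r ∧
    (m + 1 ≠ r → (DepthGamma.remainderPoly m r z).natDegree = m + r) := by
  refine ⟨fun t ht => ?_, DepthGamma.natDegree_remainderPoly_le m r hr z,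
    fun hmr => DepthGamma.natDegree_remainderPoly m r hr hmr z⟩
  obtain ⟨s, rfl⟩ := Nat.exists_eq_add_of_le' hr
  rw [DepthGamma.iteratedDigamma_eq_closedForm m s
    (DepthGamma.segment_subset_slitPlane_iff.1 ht), DepthGamma.closedForm_eq]
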